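/- Let $n\ge 3$; all coordinate indices are read in $\mathbb Z/n\mathbb Z$ (so index $0$ means $n$). For $l\ge 1$ let $B_l$ and $B_l^\vee$ be two copies of the set $\{x=(x_1,\dots,x_n)\in\mathbb Z_{\ge0}^n : x_1+\cdots+x_n=l\}$, and for $X=B_l$ or $B_l^\vee$ let $\mathrm{Aff}(X)=\{z^dx : d\in\mathbb Z,\ x\in X\}$. Put $$Q_i(x,y)=\min_{1\le k\le n}\Bigl(\sum_{j=1}^{k-1}x_{i+j}+\sum_{j=k+1}^{n}y_{i+j}\Bigr),\qquad P_i(x,y)=\min(x_{i+1},y_{i+1}).$$ The combinatorial $R$ maps are - $R:\mathrm{Aff}(B_l)\otimes\mathrm{Aff}(B_m)\to\mathrm{Aff}(B_m)\otimes\mathrm{Aff}(B_l)$, $z^dx\otimes z^ey\mapsto z^{e-Q_0(x,y)}\tilde y\otimes z^{d+Q_0(x,y)}\tilde x$ with $\tilde x_i=x_i+Q_i(x,y)-Q_{i-1}(x,y)$, $\tilde y_i=y_i+Q_{i-1}(x,y)-Q_i(x,y)$; - $R^\vee:\mathrm{Aff}(B_l)\otimes\mathrm{Aff}(B^\vee_m)\to\mathrm{Aff}(B^\vee_m)\otimes\mathrm{Aff}(B_l)$,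 $z^dx\otimes z^ey\mapsto z^{e-P_0(x,y)}\tilde y\otimes z^{d+P_0(x,y)}\tilde x$ with $\tilde x_i=x_i+P_i(x,y)-P_{i-1}(x,y)$, $\tilde y_i=y_i+P_i(x,y)-P_{i-1}(x,y)$; - $R^{\vee\vee}:\mathrm{Aff}(B^\vee_l)\otimes\mathrm{Aff}(B^\vee_m)\to\mathrm{Aff}(B^\vee_m)\otimes\mathrm{Aff}(B^\vee_l)$, $z^dx\otimes z^ey\mapsto z^{e-Q_0(y,x)}\tilde y\otimes z^{d+Q_0(y,x)}\tilde x$ with $\tilde x_i=x_i+Q_{i-1}(y,x)-Q_i(y,x)$, $\tilde y_i=y_i+Q_i(y,x)-Q_{i-1}(y,x)$. We write $a\otimes b\simeq b'\otimes a'$ when $b'\otimes a'$ is the image of $a\otimes b$ under one of these maps or, for elements without a factor $z^d$, under the map with the $z$-exponents ignored. Let $(\kappa,I)$ be one of the following: - $\kappa(x)=(x_2,\dots,x_n,x_1)$, $I(x)=-x_1$ (any $n$); - $\kappa(x)=(x_n,x_3,x_2,x_5,x_4,\dots,x_{n-1},x_{n-2},x_1)$, $I(x)=x_n-x_1$ ($n$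 even); - $\kappa(x)=(x_2,x_1,x_4,x_3,\dots,x_n,x_{n-1})$, $I(x)=0$ ($n$ even); and let $K:\mathrm{Aff}(B_l)\to\mathrm{Aff}(B_l^\vee)$, $K(z^dx)=z^{-d+I(x)}\kappa(x)$. Put $u_l=(l,0,\dots,0)\in B_l$, $u_l^\vee=\kappa(u_l)\in B_l^\vee$, $B=B_1\otimes B_1^\vee$ and $\mathrm{vac}=u_1\otimes u_1^\vee\in B$. Let $\mathcal P$ be the set of states $p=\cdots\otimes p_2\otimes p_1$ with $p_k\in B$ for all $k\ge 1$ and $p_k=\mathrm{vac}$ for all sufficiently large $k$. For $l\ge1$ and $p\in\mathcal P$, the time evolution $T_l(p)\in\mathcal P$ is defined, together with $v\in B_l$ and $p^\dagger\in\mathcal P$, by repeated application of the $R$ maps: $$u_l\otimes p\simeq p^\dagger\otimes v,\qquad p^\dagger\otimes\kappa(v)\simeq u_l^\vee\otimes T_l(p).$$ Here $u_l$ enters from the far left and passes through all sites of $p$, then $\kappa(v)$ passes back through all sites of $p^\dagger$; this makes sense since $u_l\otimes\mathrm{vac}\simeq\mathrm{vac}\otimes u_l$, $\mathrm{vac}\otimes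 u^\vee_l\simeq u^\vee_l\otimes\mathrm{vac}$, and the returning element becomes $u_l^\vee$ after sufficiently many sites. The integer $E_l(p)$ is defined by the same construction with spectral parameter: start with $z^0u_l\in\mathrm{Aff}(B_l)$, let it pass through all sites of $p$ to become $z^dv$, apply $K$, and let the result $z^{-d+I(v)}\kappa(v)$ pass back through all sites of $p^\dagger$; it finally becomes $z^{-E_l(p)+I(u_l)}u_l^\vee$, where the exponent is constant far from the end. Equivalently, with $p_i=s_i\otimes t_i$ and $p_i^\dagger=s_i^\dagger\otimes t_i^\dagger$, $$E_l(p)=\sum_{i\ge1}\bigl(Q_0(v_i,s_i)+P_0(v_i^\sharp,t_i)\bigr)+\sum_{i\ge1}\bigl(Q_0(w_i,t_i^\dagger)+P_0(w_i^\sharp,s_i^\dagger)\bigr)-I(v)+I(u_l),$$ where $v_i\in B_l$ and $w_i\in B_l^\vee$ are the passing elements on entering site $i$ on the way to the end and on the way back, and $v_i\otimes s_i\simeq s_i^\dagger\otimes v_i^\sharp$, $t_i^\dagger\otimes w_i\simeq w_i^\sharp\otimes t_i'$ (with $t_i'\in B_1^\vee$ the second factor of $T_l(p)_i$). **Proposition.**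 $E_l$ is invariant under the time evolutions: $E_l(T_m(p))=E_l(p)$ for all $l,m\ge 1$ and all $p\in\mathcal P$. -/

import Mathlib

namespace BoxBall

instance neZero_of_fact {n : ℕ} [h : Fact (3 ≤ n)] : NeZero n := ⟨by have := h.out; omega⟩

/-! ## Crystals and affinization

All coordinates are indexed by `ZMod n`; the coordinate `x_n` is `x 0`. -/

/-- The set of arrays `(x_1, …, x_n)` of nonnegative integers with sum `l`,
which parameterizes both crystals below. -/
abbrev Arr (n l : ℕ) [NeZero n] : Type :=
  {x : ZMod n → ℤ // (∀ i, 0 ≤ x i) ∧ ∑ i, x i = (l : ℤ)}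

/-- `B_l`: the entry `x_i` is the number of letters `i` in a row of length `l`. -/
abbrev B (n l : ℕ) [NeZero n] : Type := Arr n l

/-- `B^∨_l`: the entry `x_i` is the number of columns (of height `n - 1`) that lack the letter
`i` in an `(n - 1) × l` rectangular tableau. -/
abbrev Bv (n l : ℕ) [NeZero n] : Type := Arr n l

/-- The affinization: `(d, x)` stands for `z^d x`. -/
abbrev Aff (X : Type) : Type := ℤ × X

section Functions

variable {n : ℕ}

/-- `Q_i(x,y) = min_{1 ≤ k ≤ n} (∑_{j=1}^{k-1} x_{i+j} + ∑_{j=k+1}^n y_{i+j})`. -/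
def Q [NeZero n] (x y : ZMod n → ℤ) (i : ZMod n) : ℤ :=
  (Finset.Icc 1 n).inf' (Finset.nonempty_Icc.2 NeZero.one_le) fun k =>
    ∑ j ∈ Finset.Ico 1 k, x (i + (j : ZMod n)) + ∑ j ∈ Finset.Ioc k n, y (i + (j : ZMod n))

/-- `P_i(x,y) = min (x_{i+1}, y_{i+1})`. -/
def P (x y : ZMod n → ℤ) (i : ZMod n) : ℤ := min (x (i + 1)) (y (i + 1))

variable [NeZero n]

set_option linter.unusedSectionVars false

theorem Q_le (x y : ZMod n → ℤ) (i : ZMod n) {k : ℕ} (h1 : 1 ≤ k) (h2 : k ≤ n) :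
    Q x y i ≤ ∑ j ∈ Finset.Ico 1 k, x (i + (j : ZMod n))
      + ∑ j ∈ Finset.Ioc k n, y (i + (j : ZMod n)) :=
  Finset.inf'_le (fun k : ℕ => ∑ j ∈ Finset.Ico 1 k, x (i + (j : ZMod n))
    + ∑ j ∈ Finset.Ioc k n, y (i + (j : ZMod n))) (Finset.mem_Icc.2 ⟨h1, h2⟩)

theorem exists_Q_eq (x y : ZMod n → ℤ) (i : ZMod n) : ∃ k, 1 ≤ k ∧ k ≤ n ∧
    Q x y i = ∑ j ∈ Finset.Ico 1 k, x (i + (j : ZMod n))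
      + ∑ j ∈ Finset.Ioc k n, y (i + (j : ZMod n)) := by
  obtain ⟨k, hk, h⟩ := Finset.exists_mem_eq_inf' (Finset.nonempty_Icc.2 (NeZero.one_le (n := n)))
    (fun k : ℕ => ∑ j ∈ Finset.Ico 1 k, x (i + (j : ZMod n))
      + ∑ j ∈ Finset.Ioc k n, y (i + (j : ZMod n)))
  exact ⟨k, (Finset.mem_Icc.1 hk).1, (Finset.mem_Icc.1 hk).2, h⟩

theorem sum_window (f : ZMod n → ℤ) (i : ZMod n) :
    ∑ j ∈ Finset.Ioc 0 n, f (i + (j : ZMod n)) = ∑ a, f a := by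
  have h0 : ∑ j ∈ Finset.range n, f (i + 1 + (j : ZMod n)) = ∑ a, f (i + 1 + a) := by
    refine Finset.sum_nbij' (fun j => (j : ZMod n)) (fun a => a.val) ?_ ?_ ?_ ?_ ?_
    · simp
    · intro a _
      exact Finset.mem_range.2 (ZMod.val_lt a)
    · intro j hj
      exact ZMod.val_cast_of_lt (Finset.mem_range.1 hj)
    · intro a _
      exact ZMod.natCast_zmod_val a
    · simp
  have h1 : ∑ a, f (i + 1 + a) = ∑ a, f a := Equiv.sum_comp (Equiv.addLeft (i + 1)) f
  rw [← h1, ← h0, Finset.range_eq_Ico]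
  refine Finset.sum_nbij' (fun j => j - 1) (fun j => j + 1) ?_ ?_ ?_ ?_ ?_
  · intro j hj
    simp only [Finset.mem_Ioc, Finset.mem_Ico] at *
    omega
  · intro j hj
    simp only [Finset.mem_Ioc, Finset.mem_Ico] at *
    omega
  · intro j hj
    simp only [Finset.mem_Ioc] at *
    omega
  · intro j hj
    omega
  · intro j hj
    simp only [Finset.mem_Ioc] at hj
    rw [Nat.cast_sub (by omega)]
    congr 1
    push_cast
    ring

theorem sum_Ico_shift (f : ZMod n → ℤ) (i : ZMod n) {k : ℕ} (hk : 1 ≤ k) :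
    ∑ j ∈ Finset.Ico 1 (k + 1), f (i + (j : ZMod n))
      = f (i + 1) + ∑ j ∈ Finset.Ico 1 k, f (i + 1 + (j : ZMod n)) := by
  rw [Finset.sum_eq_sum_Ico_succ_bot (by omega),
    ← Finset.sum_Ico_add' (fun j : ℕ => f (i + (j : ZMod n))) 1 k 1]
  congr 1
  · simp
  · refine Finset.sum_congr rfl fun j _ => ?_
    congr 1
    push_cast
    ring

theorem sum_Ioc_shift (f : ZMod n → ℤ) (i : ZMod n) (k m : ℕ) :
    ∑ j ∈ Finset.Ioc (k + 1) (m + 1), f (i + (j : ZMod n))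
      = ∑ j ∈ Finset.Ioc k m, f (i + 1 + (j : ZMod n)) := by
  have e : ∀ a b : ℕ, Finset.Ioc a b = Finset.Ico (a + 1) (b + 1) := by
    intro a b
    ext j
    simp only [Finset.mem_Ioc, Finset.mem_Ico]
    omega
  rw [e, e, ← Finset.sum_Ico_add' (fun j : ℕ => f (i + (j : ZMod n))) (k + 1) (m + 1) 1]
  refine Finset.sum_congr rfl fun j _ => ?_
  congr 1
  push_cast
  ring

theorem sum_nonneg' {f : ZMod n → ℤ} (hf : ∀ i, 0 ≤ f i) (i : ZMod n) (s : Finset ℕ) :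
    0 ≤ ∑ j ∈ s, f (i + (j : ZMod n)) := Finset.sum_nonneg fun _ _ => hf _

theorem sum_mono' {f : ZMod n → ℤ} (hf : ∀ i, 0 ≤ f i) (i : ZMod n) {s t : Finset ℕ}
    (h : s ⊆ t) : ∑ j ∈ s, f (i + (j : ZMod n)) ≤ ∑ j ∈ t, f (i + (j : ZMod n)) :=
  Finset.sum_le_sum_of_subset_of_nonneg h fun _ _ _ => hf _

theorem Q_nonneg {x y : ZMod n → ℤ} (hx : ∀ i, 0 ≤ x i) (hy : ∀ i, 0 ≤ y i) (i : ZMod n) :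
    0 ≤ Q x y i := by
  obtain ⟨k, -, -, h⟩ := exists_Q_eq x y i
  rw [h]
  exact add_nonneg (sum_nonneg' hx _ _) (sum_nonneg' hy _ _)

theorem Q_le_left {x y : ZMod n → ℤ} (hx : ∀ i, 0 ≤ x i) (hy : ∀ i, 0 ≤ y i) (i : ZMod n) :
    Q x y i ≤ x (i + 1) + Q x y (i + 1) := by
  obtain ⟨k, h1, h2, h⟩ := exists_Q_eq x y (i + 1)
  have hs := sum_Ico_shift x i h1
  rcases h2.lt_or_eq with h3 | rfl
  · have := Q_le x y i (k := k + 1) (by omega) h3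
    have h4 : ∑ j ∈ Finset.Ioc (k + 1) n, y (i + (j : ZMod n))
        ≤ ∑ j ∈ Finset.Ioc (k + 1) (n + 1), y (i + (j : ZMod n)) :=
      sum_mono' hy _ (Finset.Ioc_subset_Ioc_right (by omega))
    rw [sum_Ioc_shift] at h4
    linarith
  · have := Q_le x y i (k := k) h1 le_rfl
    have h4 : ∑ j ∈ Finset.Ico 1 k, x (i + (j : ZMod k))
        ≤ ∑ j ∈ Finset.Ico 1 (k + 1), x (i + (j : ZMod k)) :=
      sum_mono' hx _ (Finset.Ico_subset_Ico_right (by omega))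
    simp only [Finset.Ioc_self, Finset.sum_empty] at *
    linarith

theorem Q_le_right {x y : ZMod n → ℤ} (hx : ∀ i, 0 ≤ x i) (hy : ∀ i, 0 ≤ y i) (i : ZMod n) :
    Q x y (i + 1) ≤ y (i + 1) + Q x y i := by
  obtain ⟨k, h1, h2, h⟩ := exists_Q_eq x y i
  have hl : y (i + 1 + ((n : ℕ) : ZMod n)) = y (i + 1) := by simp
  rcases h1.lt_or_eq with h3 | rfl
  · obtain ⟨k, rfl⟩ : ∃ k', k = k' + 1 := ⟨k - 1, by omega⟩
    have := Q_le x y (i + 1) (k := k) (by omega) (by omega)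
    have hs := sum_Ico_shift x i (k := k) (by omega)
    have h4 := sum_Ioc_shift y i k n
    rw [Finset.sum_Ioc_succ_top (by omega)] at h4
    have h5 : y (i + ((n + 1 : ℕ) : ZMod n)) = y (i + 1) := by simp
    have := hx (i + 1)
    linarith
  · have := Q_le x y (i + 1) (k := 1) le_rfl h2
    simp only [Finset.Ico_self, Finset.sum_empty] at *
    have h7 : ∑ j ∈ Finset.Ioc 1 n, y (i + 1 + (j : ZMod n))
        ≤ ∑ j ∈ Finset.Ioc 0 n, y (i + 1 + (j : ZMod n)) :=
      sum_mono' hy _ (Finset.Ioc_subset_Ioc_left (by omega))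
    have h8 := sum_window y (i + 1)
    have h9 := sum_window y i
    have h10 : Finset.Ioc 0 n = insert 1 (Finset.Ioc 1 n) := by
      ext j
      simp only [Finset.mem_Ioc, Finset.mem_insert]
      omega
    rw [h10, Finset.sum_insert (by simp)] at h9
    simp only [Nat.cast_one] at h9
    linarith

theorem sum_add_sub_shift (f g : ZMod n → ℤ) :
    ∑ i, (f i + g i - g (i - 1)) = ∑ i, f i := by
  have : ∑ i, g (i - 1) = ∑ i, g i := Equiv.sum_comp (Equiv.subRight (1 : ZMod n)) g
  rw [Finset.sum_sub_distrib, Finset.sum_add_distrib, this]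
  ring

theorem sum_add_shift_sub (f g : ZMod n → ℤ) :
    ∑ i, (f i + g (i - 1) - g i) = ∑ i, f i := by
  have : ∑ i, g (i - 1) = ∑ i, g i := Equiv.sum_comp (Equiv.subRight (1 : ZMod n)) g
  rw [Finset.sum_sub_distrib, Finset.sum_add_distrib, this]
  ring

/-! ## Combinatorial `R` -/

/-- `x_i + Q_i(x,y) - Q_{i-1}(x,y)`. -/
def upQ {l m : ℕ} (x : Arr n l) (y : Arr n m) : Arr n l :=
  ⟨fun i => x.1 i + Q x.1 y.1 i - Q x.1 y.1 (i - 1), fun i => by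
    have := Q_le_left x.2.1 y.2.1 (i - 1)
    rw [sub_add_cancel] at this
    linarith, by rw [sum_add_sub_shift]; exact x.2.2⟩

/-- `y_i + Q_{i-1}(x,y) - Q_i(x,y)`. -/
def downQ {l m : ℕ} (x : Arr n l) (y : Arr n m) : Arr n m :=
  ⟨fun i => y.1 i + Q x.1 y.1 (i - 1) - Q x.1 y.1 i, fun i => by
    have := Q_le_right x.2.1 y.2.1 (i - 1)
    rw [sub_add_cancel] at this
    linarith, by rw [sum_add_shift_sub]; exact y.2.2⟩

/-- `x_i + P_i(x,y) - P_{i-1}(x,y)`. -/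
def shiftP {l m : ℕ} (x : Arr n l) (y : Arr n m) : Arr n l :=
  ⟨fun i => x.1 i + P x.1 y.1 i - P x.1 y.1 (i - 1), fun i => by
    have h1 := x.2.1 (i + 1)
    have h2 := y.2.1 (i + 1)
    have h3 : P x.1 y.1 (i - 1) ≤ x.1 i := by
      unfold P
      rw [sub_add_cancel]
      exact min_le_left _ _
    have h4 : 0 ≤ P x.1 y.1 i := le_min h1 h2
    linarith, by rw [sum_add_sub_shift]; exact x.2.2⟩

/-- `R : Aff(B_l) ⊗ Aff(B_m) → Aff(B_m) ⊗ Aff(B_l)`,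
`z^d x ⊗ z^e y ↦ z^{e - Q_0(x,y)} ỹ ⊗ z^{d + Q_0(x,y)} x̃`. -/
def R {l m : ℕ} (a : Aff (B n l)) (b : Aff (B n m)) : Aff (B n m) × Aff (B n l) :=
  ((b.1 - Q a.2.1 b.2.1 0, downQ a.2 b.2), (a.1 + Q a.2.1 b.2.1 0, upQ a.2 b.2))

/-- `R^∨ : Aff(B_l) ⊗ Aff(B^∨_m) → Aff(B^∨_m) ⊗ Aff(B_l)`,
`z^d x ⊗ z^e y ↦ z^{e - P_0(x,y)} ỹ ⊗ z^{d + P_0(x,y)} x̃`. -/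
def Rv {l m : ℕ} (a : Aff (B n l)) (b : Aff (Bv n m)) : Aff (Bv n m) × Aff (B n l) :=
  ((b.1 - P a.2.1 b.2.1 0, shiftP b.2 a.2), (a.1 + P a.2.1 b.2.1 0, shiftP a.2 b.2))

/-- `R^∨∨ : Aff(B^∨_l) ⊗ Aff(B^∨_m) → Aff(B^∨_m) ⊗ Aff(B^∨_l)`,
`z^d x ⊗ z^e y ↦ z^{e - Q_0(y,x)} ỹ ⊗ z^{d + Q_0(y,x)} x̃`. -/
def Rvv {l m : ℕ} (a : Aff (Bv n l)) (b : Aff (Bv n m)) : Aff (Bv n m) × Aff (Bv n l) :=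
  ((b.1 - Q b.2.1 a.2.1 0, upQ b.2 a.2), (a.1 + Q b.2.1 a.2.1 0, downQ b.2 a.2))

end Functions

/-! ## Combinatorial `K` -/

/-- The three choices of the reflecting end: `Rotateleft` for any `n`, and
`Switch_{1n}`, `Switch_{12}` for even `n`. -/
inductive Reflector (n : ℕ) : Type
  | rotateLeft : Reflector n
  | switch1n (h : Even n) : Reflector n
  | switch12 (h : Even n) : Reflector n

section Kmap

variable {n : ℕ} [NeZero n]

/-- The involution exchanging `i` and `i + 1` for every even residue `i` (`n` even),
i.e. `1 ↔ n`, `2 ↔ 3`, …, `n - 2 ↔ n - 1`. -/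
def swapEven (i : ZMod n) : ZMod n := if Even i.val then i + 1 else i - 1

/-- The involution exchanging `i` and `i + 1` for every odd residue `i` (`n` even),
i.e. `1 ↔ 2`, `3 ↔ 4`, …, `n - 1 ↔ n`. -/
def swapOdd (i : ZMod n) : ZMod n := if Even i.val then i - 1 else i + 1

theorem even_val_add_one (h : Even n) (i : ZMod n) : Even (i + 1).val ↔ ¬ Even i.val := by
  have hn : n ≠ 0 := NeZero.ne n
  have h2 : 1 < n := by
    rcases h with ⟨k, rfl⟩
    omega
  have : Fact (1 < n) := ⟨h2⟩
  rw [ZMod.val_add, ZMod.val_one, Nat.even_iff, Nat.even_iff,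
    Nat.mod_mod_of_dvd _ (even_iff_two_dvd.1 h)]
  omega

theorem even_val_sub_one (h : Even n) (i : ZMod n) : Even (i - 1).val ↔ ¬ Even i.val := by
  have := even_val_add_one h (i - 1)
  rw [sub_add_cancel] at this
  tauto

theorem swapEven_involutive (h : Even n) : Function.Involutive (swapEven (n := n)) := by
  intro i
  by_cases hi : Even i.val
  · simp [swapEven, hi, even_val_add_one h]
  · simp [swapEven, hi, even_val_sub_one h]

theorem swapOdd_involutive (h : Even n) : Function.Involutive (swapOdd (n := n)) := by
  intro i
  by_cases hi : Even i.val
  · simp [swapOdd, hi, even_val_sub_one h]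
  · simp [swapOdd, hi, even_val_add_one h]

/-- The permutation `σ` of the coordinates such that `κ(x)_i = x_{σ(i)}`. -/
def Reflector.perm : Reflector n → Equiv.Perm (ZMod n)
  | .rotateLeft => Equiv.addRight 1
  | .switch1n h => (swapEven_involutive h).toPerm
  | .switch12 h => (swapOdd_involutive h).toPerm

/-- `κ : B_l → B^∨_l`. -/
def Reflector.kappa (κ : Reflector n) {l : ℕ} (x : B n l) : Bv n l :=
  ⟨fun i => x.1 (κ.perm i), fun i => x.2.1 _, by
    rw [Equiv.sum_comp κ.perm x.1]; exact x.2.2⟩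

/-- `I(x) = -x_1`, `x_n - x_1`, `0` in the three cases. -/
def Reflector.I {l : ℕ} : Reflector n → B n l → ℤ
  | .rotateLeft, x => - x.1 1
  | .switch1n _, x => x.1 0 - x.1 1
  | .switch12 _, _ => 0

/-- `K : Aff(B_l) → Aff(B^∨_l)`, `z^d x ↦ z^{-d + I(x)} κ(x)`. -/
def Reflector.K (κ : Reflector n) {l : ℕ} (a : Aff (B n l)) : Aff (Bv n l) :=
  (-a.1 + κ.I a.2, κ.kappa a.2)

/-- The array whose only nonzero entry is `l`, in position `a`. -/
def single (l : ℕ) (a : ZMod n) : Arr n l :=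
  ⟨Pi.single a (l : ℤ), fun i => by
    by_cases h : i = a
    · subst h; simp
    · simp [h], by simp⟩

/-- `u_l = (l, 0, …, 0) ∈ B_l`. -/
def u (n l : ℕ) [NeZero n] : B n l := single l 1

/-- `u^∨_l = κ(u_l) ∈ B^∨_l`. -/
def uv (κ : Reflector n) (l : ℕ) : Bv n l := κ.kappa (u n l)

end Kmap

/-! ## States -/

/-- Local states `B = B_1 ⊗ B^∨_1`. -/
abbrev Local (n : ℕ) [NeZero n] : Type := B n 1 × Bv n 1

/-- `vac = 1 ⊗ κ(1)`. -/
def vac {n : ℕ} [NeZero n] (κ : Reflector n) : Local n := (u n 1, uv κ 1)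

/-- A state of the semi-infinite lattice: `site k` is the local state `p_{k+1}` at distance `k`
from the reflecting end; all the distant local states are `vac`. -/
@[ext]
structure State {n : ℕ} [NeZero n] (κ : Reflector n) where
  site : ℕ → Local n
  eventually_vac : ∃ N, ∀ k, N ≤ k → site k = vac κ

section Rows

variable {n : ℕ} [NeZero n]

/-- A solid carrier passes through one site: `a ⊗ (s ⊗ t) ≃ (s† ⊗ t†) ⊗ a'`. The spectral parameter
is attached to the carrier; those of the local states are irrelevant and are dropped. -/
def rowDown {l : ℕ} (a : Aff (B n l)) (b : Local n) : Local n × Aff (B n l) :=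
  let r := R a (0, b.1)
  let r' := Rv r.2 (0, b.2)
  ((r.1.2, r'.1.2), r'.2)

/-- A dotted carrier passes through one site: `(s† ⊗ t†) ⊗ a ≃ a' ⊗ (s' ⊗ t')`. -/
def rowUp {l : ℕ} (b : Local n) (a : Aff (Bv n l)) : Aff (Bv n l) × Local n :=
  let r := Rvv (0, b.2) a
  let r' := Rv (0, b.1) r.1
  (r'.1, (r'.2.2, r.2.2))

variable {κ : Reflector n}

/-- The solid carrier that starts as `z^0 u_l` and passes through the sites with indices
`i + k - 1, …, i + 1, i`, in this order. -/
def carrierFrom (l : ℕ) (p : State κ) : ℕ → ℕ → Aff (B n l)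
  | 0, _ => (0, u n l)
  | k + 1, i => (rowDown (carrierFrom l p k (i + 1)) (p.site i)).2

/-- The solid carrier `v_i` (with its spectral parameter): it comes from the far left as `z^0 u_l`,
has passed through all the sites of index `≥ i` and is about to enter the site of index `i - 1`
(or the reflecting end if `i = 0`). -/
noncomputable def solid (l : ℕ) (p : State κ) (i : ℕ) : Aff (B n l) :=
  carrierFrom l p (Classical.choose p.eventually_vac) i

/-- The intermediate local states `p†`. -/
noncomputable def dagger (l : ℕ) (p : State κ) (i : ℕ) : Local n :=
  (rowDown (solid l p (i + 1)) (p.site i)).1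

/-- The dotted carrier (with its spectral parameter): it leaves the reflecting end as `K(z^d v)`,
has passed through the sites of index `< i`, and is about to enter the site of index `i`. -/
noncomputable def dotted (l : ℕ) (p : State κ) : ℕ → Aff (Bv n l)
  | 0 => κ.K (solid l p 0)
  | i + 1 => (rowUp (dagger l p i) (dotted l p i)).1

/-- The local states after one sweep of the carrier to the reflecting end and back. -/
noncomputable def evolvedSite (l : ℕ) (p : State κ) (i : ℕ) : Local n :=
  (rowUp (dagger l p i) (dotted l p i)).2

end Rows

/-! ## Convergence -/

section Convergence

variable {n : ℕ}

theorem single_apply_self [NeZero n] (l : ℕ) (a : ZMod n) : (single l a).1 a = l := by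
  simp [single]

theorem single_apply_ne [NeZero n] (l : ℕ) {a i : ZMod n} (h : i ≠ a) : (single l a).1 i = 0 := by
  simp [single, h]

theorem eq_single [NeZero n] {l : ℕ} {a : ZMod n} (x : Arr n l) (h : (l : ℤ) ≤ x.1 a) :
    x = single l a := by
  have hs := x.2.2
  rw [← Finset.add_sum_erase _ _ (Finset.mem_univ a)] at hs
  have h0 : 0 ≤ ∑ i ∈ Finset.univ.erase a, x.1 i := Finset.sum_nonneg fun i _ => x.2.1 i
  have h1 : ∑ i ∈ Finset.univ.erase a, x.1 i = 0 := by linarith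
  have h2 := (Finset.sum_eq_zero_iff_of_nonneg fun i _ => x.2.1 i).1 h1
  apply Subtype.ext
  funext i
  by_cases hi : i = a
  · subst hi
    rw [single_apply_self]
    linarith
  · rw [single_apply_ne l hi]
    exact h2 i (by simp [hi])

theorem Q_single [NeZero n] (l m : ℕ) (a i : ZMod n) :
    Q (single l a).1 (single m a).1 i = 0 := by
  refine le_antisymm ?_ (Q_nonneg (single l a).2.1 (single m a).2.1 i)
  have hv := ZMod.val_lt (a - i - 1)
  have hn : ∀ j : ℕ, 1 ≤ j → j ≤ n → j ≠ (a - i - 1).val + 1 → i + (j : ZMod n) ≠ a := by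
    intro j h1 h2 h3 h4
    apply h3
    have : a - i - 1 = ((j - 1 : ℕ) : ZMod n) := by
      rw [Nat.cast_sub h1, ← h4]
      push_cast
      ring
    rw [this, ZMod.val_cast_of_lt (by omega)]
    omega
  refine (Q_le _ _ i (k := (a - i - 1).val + 1) (by omega) (by omega)).trans (le_of_eq ?_)
  rw [Finset.sum_eq_zero, Finset.sum_eq_zero, add_zero]
  · intro j hj
    rw [Finset.mem_Ioc] at hj
    exact single_apply_ne _ (hn j (by omega) (by omega) (by omega))
  · intro j hj
    rw [Finset.mem_Ico] at hj
    exact single_apply_ne _ (hn j (by omega) (by omega) (by omega))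

theorem P_single [NeZero n] (l m : ℕ) {a b : ZMod n} (h : a ≠ b) (i : ZMod n) :
    P (single l a).1 (single m b).1 i = 0 := by
  have h1 := (single (n := n) l a).2.1 (i + 1)
  have h2 := (single (n := n) m b).2.1 (i + 1)
  unfold P
  by_cases hi : i + 1 = a
  · rw [single_apply_ne m (fun e => h (hi.symm.trans e)), min_eq_right h1]
  · rw [single_apply_ne l hi, min_eq_left h2]

theorem upQ_single [NeZero n] (l m : ℕ) (a : ZMod n) :
    upQ (single l a) (single m a) = single l a := by
  apply Subtype.ext
  funext i
  simp [upQ, Q_single]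

theorem downQ_single [NeZero n] (l m : ℕ) (a : ZMod n) :
    downQ (single l a) (single m a) = single m a := by
  apply Subtype.ext
  funext i
  simp [downQ, Q_single]

theorem shiftP_single [NeZero n] (l m : ℕ) {a b : ZMod n} (h : a ≠ b) :
    shiftP (single l a) (single m b) = single l a := by
  apply Subtype.ext
  funext i
  simp [shiftP, P_single l m h]

/-- The position of the nonzero entry of `κ(u_l)`. -/
def Reflector.pos [NeZero n] (κ : Reflector n) : ZMod n := κ.perm.symm 1

theorem uv_eq [NeZero n] (κ : Reflector n) (l : ℕ) : uv κ l = single l κ.pos := by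
  apply eq_single
  simp [uv, Reflector.kappa, Reflector.pos, u, single]

theorem one_ne_pos [Fact (3 ≤ n)] (κ : Reflector n) : (1 : ZMod n) ≠ κ.pos := by
  have h3 : 3 ≤ n := Fact.out
  have : Fact (1 < n) := ⟨by omega⟩
  intro h
  have h1 : κ.perm 1 = 1 := by
    conv_lhs => rw [h]
    simp [Reflector.pos]
  cases κ with
  | rotateLeft => simp [Reflector.perm] at h1
  | switch1n hn => simp [Reflector.perm, swapEven, ZMod.val_one] at h1
  | switch12 hn => simp [Reflector.perm, swapOdd, ZMod.val_one] at h1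

theorem rowDown_vac [Fact (3 ≤ n)] (κ : Reflector n) (l : ℕ) (d : ℤ) :
    rowDown (d, u n l) (vac κ) = (vac κ, (d, u n l)) := by
  have h := one_ne_pos κ
  simp [rowDown, vac, R, Rv, uv_eq, u, upQ_single, downQ_single, shiftP_single _ _ h,
    shiftP_single _ _ h.symm, Q_single, P_single _ _ h]

theorem rowUp_vac [Fact (3 ≤ n)] (κ : Reflector n) (l : ℕ) (d : ℤ) :
    rowUp (vac κ) (d, uv κ l) = ((d, uv κ l), vac κ) := by
  have h := one_ne_pos κ
  simp [rowUp, vac, Rvv, Rv, uv_eq, u, upQ_single, downQ_single, shiftP_single _ _ h,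
    shiftP_single _ _ h.symm, Q_single, P_single _ _ h]

theorem carrierFrom_eq [Fact (3 ≤ n)] {κ : Reflector n} (l : ℕ) (p : State κ) {N : ℕ}
    (hN : ∀ k, N ≤ k → p.site k = vac κ) :
    ∀ k i, N ≤ i → carrierFrom l p k i = (0, u n l) := by
  intro k
  induction k with
  | zero => intro i _; rfl
  | succ k ih =>
    intro i hi
    rw [carrierFrom, ih (i + 1) (by omega), hN i hi, rowDown_vac]

theorem carrierFrom_succ [Fact (3 ≤ n)] {κ : Reflector n} (l : ℕ) (p : State κ) {N : ℕ}
    (hN : ∀ k, N ≤ k → p.site k = vac κ) :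
    ∀ k i, N ≤ i + k → carrierFrom l p (k + 1) i = carrierFrom l p k i := by
  intro k
  induction k with
  | zero =>
    intro i hi
    rw [carrierFrom_eq l p hN _ i hi, carrierFrom]
  | succ k ih =>
    intro i hi
    rw [carrierFrom, ih (i + 1) (by omega), ← carrierFrom]

/-- The solid carrier is `z^0 u_l` far away from the end. -/
theorem solid_eventually [Fact (3 ≤ n)] {κ : Reflector n} (l : ℕ) (p : State κ) :
    ∃ N, ∀ i, N ≤ i → solid l p i = (0, u n l) :=
  ⟨_, carrierFrom_eq l p (Classical.choose_spec p.eventually_vac) _⟩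

/-- The solid carriers on both sides of a site: together with `solid_eventually` this
determines `solid`. -/
theorem solid_step [Fact (3 ≤ n)] {κ : Reflector n} (l : ℕ) (p : State κ) (i : ℕ) :
    solid l p i = (rowDown (solid l p (i + 1)) (p.site i)).2 := by
  have h := Classical.choose_spec p.eventually_vac
  unfold solid
  rw [← carrierFrom_succ l p h _ i (by omega), carrierFrom]

theorem dagger_eventually [Fact (3 ≤ n)] {κ : Reflector n} (l : ℕ) (p : State κ) :
    ∃ N, ∀ i, N ≤ i → dagger l p i = vac κ := by
  obtain ⟨N, hN⟩ := solid_eventually l p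
  obtain ⟨M, hM⟩ := p.eventually_vac
  refine ⟨N + M, fun i hi => ?_⟩
  rw [dagger, hN _ (by omega), hM _ (by omega), rowDown_vac]

theorem Q_single_right_pred [NeZero n] {l : ℕ} (x : Arr n l) (m : ℕ) (a : ZMod n) :
    Q x.1 (single m a).1 (a - 1) = 0 := by
  refine le_antisymm ?_ (Q_nonneg x.2.1 (single m a).2.1 _)
  refine (Q_le _ _ (a - 1) (k := 1) le_rfl NeZero.one_le).trans (le_of_eq ?_)
  rw [Finset.Ico_self, Finset.sum_empty, zero_add]
  refine Finset.sum_eq_zero fun j hj => single_apply_ne _ fun h => ?_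
  rw [Finset.mem_Ioc] at hj
  have h1 : ((j - 1 : ℕ) : ZMod n) = 0 := by
    rw [Nat.cast_sub (by omega)]
    have : (j : ZMod n) = 1 := by linear_combination h
    simp [this]
  have h2 := congrArg ZMod.val h1
  rw [ZMod.val_cast_of_lt (by omega), ZMod.val_zero] at h2
  omega

theorem Q_single_right [NeZero n] {l : ℕ} (x : Arr n l) (a : ZMod n) :
    min 1 ((l : ℤ) - x.1 a) ≤ Q x.1 (single 1 a).1 a := by
  obtain ⟨k, h1, h2, h⟩ := exists_Q_eq x.1 (single 1 a).1 a
  rw [h]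
  rcases h2.lt_or_eq with h3 | rfl
  · refine (min_le_left _ _).trans ?_
    have h4 : ((single 1 a).1 (a + ((n : ℕ) : ZMod n)) : ℤ)
        ≤ ∑ j ∈ Finset.Ioc k n, (single 1 a).1 (a + (j : ZMod n)) :=
      Finset.single_le_sum (f := fun j : ℕ => (single 1 a).1 (a + (j : ZMod n)))
        (fun j _ => (single 1 a).2.1 _) (Finset.mem_Ioc.2 ⟨h3, le_rfl⟩)
    have h5 : ((single 1 a).1 (a + ((n : ℕ) : ZMod n)) : ℤ) = 1 := by
      simp [single]
    have := sum_nonneg' x.2.1 a (Finset.Ico 1 k)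
    linarith
  · refine (min_le_right _ _).trans ?_
    have h4 := sum_window x.1 a
    have h5 : Finset.Ioc 0 k = insert k (Finset.Ico 1 k) := by
      ext j
      simp only [Finset.mem_Ioc, Finset.mem_insert, Finset.mem_Ico]
      omega
    rw [h5, Finset.sum_insert (by simp), x.2.2] at h4
    simp only [Finset.Ioc_self, Finset.sum_empty, CharP.cast_eq_zero, add_zero] at *
    linarith

theorem rowUp_vac_grow [Fact (3 ≤ n)] (κ : Reflector n) {l : ℕ} (a : Aff (Bv n l)) :
    min (l : ℤ) (a.2.1 κ.pos + 1) ≤ (rowUp (vac κ) a).1.2.1 κ.pos := by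
  have h := one_ne_pos κ
  have h1 := Q_single_right a.2 κ.pos
  have h2 := Q_single_right_pred a.2 1 κ.pos
  have h3 : ∀ y : Arr n l, y.1 κ.pos ≤ (shiftP y (single 1 1)).1 κ.pos := by
    intro y
    have e1 : P y.1 (single 1 1).1 (κ.pos - 1) = 0 := by
      unfold P
      rw [sub_add_cancel, single_apply_ne 1 h.symm]
      exact min_eq_right (y.2.1 _)
    have e2 : 0 ≤ P y.1 (single 1 1).1 κ.pos := le_min (y.2.1 _) ((single 1 1).2.1 _)
    simp only [shiftP, e1]
    linarith
  have h4 : (rowUp (vac κ) a).1.2 = shiftP (upQ a.2 (single 1 κ.pos)) (single 1 1) := by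
    simp [rowUp, vac, Rvv, Rv, uv_eq, u]
  rw [h4]
  refine le_trans ?_ (h3 _)
  simp only [upQ, h2]
  rcases min_cases (1 : ℤ) ((l : ℤ) - a.2.1 κ.pos) with h5 | h5 <;>
    rcases min_cases (l : ℤ) (a.2.1 κ.pos + 1) with h6 | h6 <;> linarith

/-- The dotted carrier finally becomes `z^e u^∨_l`, with a constant exponent `e`. -/
theorem dotted_eventually [Fact (3 ≤ n)] {κ : Reflector n} (l : ℕ) (p : State κ) :
    ∃ e : ℤ, ∃ N, ∀ i, N ≤ i → dotted l p i = (e, uv κ l) := by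
  obtain ⟨N, hN⟩ := dagger_eventually l p
  have h1 : ∀ k : ℕ, min (l : ℤ) k ≤ (dotted l p (N + k)).2.1 κ.pos := by
    intro k
    induction k with
    | zero => exact (min_le_right _ _).trans ((dotted l p (N + 0)).2.2.1 _)
    | succ k ih =>
      have := rowUp_vac_grow κ (dotted l p (N + k))
      rw [← add_assoc, dotted, hN _ (by omega)]
      refine le_trans ?_ this
      refine le_min (min_le_left _ _) ?_
      push_cast
      rcases min_cases (l : ℤ) (k : ℤ) with h5 | h5 <;>
        rcases min_cases (l : ℤ) ((k : ℤ) + 1) with h6 | h6 <;> linarith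
  have h2 : (dotted l p (N + l)).2 = uv κ l := by
    rw [uv_eq]
    apply eq_single
    simpa using h1 l
  refine ⟨(dotted l p (N + l)).1, N + l, fun i hi => ?_⟩
  induction i, hi using Nat.le_induction with
  | base => rw [← h2]
  | succ i hi ih => rw [dotted, ih, hN i (by omega), rowUp_vac]

theorem evolvedSite_eventually [Fact (3 ≤ n)] {κ : Reflector n} (l : ℕ) (p : State κ) :
    ∃ N, ∀ i, N ≤ i → evolvedSite l p i = vac κ := by
  obtain ⟨N, hN⟩ := dagger_eventually l p
  obtain ⟨e, M, hM⟩ := dotted_eventually l p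
  refine ⟨N + M, fun i hi => ?_⟩
  rw [evolvedSite, hN i (by omega), hM i (by omega), rowUp_vac]

end Convergence

/-! ## Time evolutions and conserved quantities -/

section Main

variable {n : ℕ} [Fact (3 ≤ n)] {κ : Reflector n}

/-- The time evolution `T_l`: `u_l ⊗ p ≃ p† ⊗ v` and `p† ⊗ κ(v) ≃ u^∨_l ⊗ T_l(p)`. -/
noncomputable def T (l : ℕ) (p : State κ) : State κ :=
  ⟨evolvedSite l p, evolvedSite_eventually l p⟩

/-- The exponent `e` such that `z^0 u_l` comes back as `z^e u^∨_l`. -/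
noncomputable def returnExponent (l : ℕ) (p : State κ) : ℤ :=
  Classical.choose (dotted_eventually l p)

/-- `E_l(p)`: the carrier `z^0 u_l` comes back as `z^{-E_l(p) + I(u_l)} u^∨_l`. -/
noncomputable def E (l : ℕ) (p : State κ) : ℤ :=
  κ.I (u n l) - returnExponent l p

/-- The defining property of `E_l(p)`. -/
theorem E_eq_iff (l : ℕ) (p : State κ) (E' : ℤ) :
    E l p = E' ↔ ∃ N, ∀ i, N ≤ i → dotted l p i = (-E' + κ.I (u n l), uv κ l) := by
  obtain ⟨N, hN⟩ := Classical.choose_spec (dotted_eventually l p)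
  have hE : Classical.choose (dotted_eventually l p) = -E l p + κ.I (u n l) := by
    unfold E returnExponent
    ring
  rw [hE] at hN
  constructor
  · rintro rfl
    exact ⟨N, hN⟩
  · rintro ⟨M, hM⟩
    have h := (hN (N + M) (by omega)).symm.trans (hM (N + M) (by omega))
    have := congrArg Prod.fst h
    simp only at this
    linarith

end Main

end BoxBall

/-! The proof is Baxter's commuting transfer matrix argument for a lattice with a boundary. Run an
`m`-carrier to the end and back, then an `l`-carrier. The Yang–Baxter equation lets two carriers
cross before or after any site, and the reflection equation does the same at the end. Hence the two
sweeps can be interchanged (`R_solid_solid`, `Rv_solid_dotted`, `Rvv_crossed_dotted`). Far from the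
end all carriers are multiples of `u` or `uv`, on which the `R` maps are plain swaps with zero
energy. So the `l`-carrier returns from `T m p` with the same power of `z` as from `p`.

These equations, energies included, are limits of identities between positive real functions.
Replace $x_i$ by $c\,e^{-x_i t}$, min by sum, sum by product and difference by quotient; then
$-\log(\cdot)/t$ recovers the combinatorial formulas as $t\to\infty$. In the lift, an array `x` is
the operator `diffOp x` on sequences, and `R` becomes the refactorization `diffOp x ∘ diffOp y =
diffOp y' ∘ diffOp x'` that exchanges the two products of coefficients (`exch_gQ`). A dotted array
enters with a minus sign (`exch_gP`).

A factorization is determined by the order of its products when these are distinct: the kernel of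
`diffOp x` is spanned by a sequence with multiplier $\prod x$ under a shift by $n$, and this locates
the rightmost factor. Uniqueness gives the Yang–Baxter equations for the arrays. It also gives the
reflection equation, once both of its sides are checked to solve the same exchange relations
(`exch_reflection`). Energies appear because $x_i-\tilde y_i=(\prod x-\prod y)/Q_i$ in the lift
(`sub_gDown`), and such differences are the factors by which a difference operator multiplies a
kernel sequence. -/

namespace BoxBall

/-! ## The subtraction-free lift -/

section Factorization

/-! ### First-order difference operators and their factorizations -/

variable {n : ℕ}

/-- The difference operator `f ↦ (i ↦ f (i + 1) - x_i f i)` on sequences. -/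
def diffOp (x : ZMod n → ℝ) (f : ℕ → ℝ) (i : ℕ) : ℝ := f (i + 1) - x i * f i

/-- `diffOp x ∘ diffOp y = diffOp y' ∘ diffOp x'`, in terms of the coefficients. -/
def Exch (x y y' x' : ZMod n → ℝ) : Prop :=
  ∀ i, x i * y i = y' i * x' i ∧ x i + y (i + 1) = y' i + x' (i + 1)

theorem Exch.symm {x y y' x' : ZMod n → ℝ} (h : Exch x y y' x') : Exch y' x' x y :=
  fun i => ⟨(h i).1.symm, (h i).2.symm⟩

theorem Exch.diffOp_eq {x y y' x' : ZMod n → ℝ} (h : Exch x y y' x') (f : ℕ → ℝ) :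
    diffOp x (diffOp y f) = diffOp y' (diffOp x' f) := by
  funext i
  have h1 := h i
  simp only [diffOp]
  push_cast
  linear_combination f i * h1.1 - f (i + 1) * h1.2

/-- On the kernel of one operator any other acts by multiplication. All the energy identities come
from computing such a multiplier in two ways. -/
theorem diffOp_of_ker {x y : ZMod n → ℝ} {f : ℕ → ℝ} (hf : diffOp x f = 0) (i : ℕ) :
    diffOp y f i = (x i - y i) * f i := by
  have := congrFun hf i
  simp only [diffOp, Pi.zero_apply] at *
  linear_combination this

/-- The generator of the kernel of `diffOp x`. -/
def kerSeq (x : ZMod n → ℝ) (i : ℕ) : ℝ := ∏ j ∈ Finset.range i, x j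

theorem diffOp_kerSeq (x : ZMod n → ℝ) : diffOp x (kerSeq x) = 0 := by
  funext i
  simp [diffOp, kerSeq, Finset.prod_range_succ, mul_comm]

theorem kerSeq_ne_zero {x : ZMod n → ℝ} (hx : ∀ i, x i ≠ 0) (i : ℕ) : kerSeq x i ≠ 0 :=
  Finset.prod_ne_zero_iff.2 fun _ _ => hx _

theorem diffOp_zero (x : ZMod n → ℝ) : diffOp x 0 = 0 := by
  funext i
  simp [diffOp]

theorem diffOp_surjective (x : ZMod n → ℝ) : Function.Surjective (diffOp x) := by
  intro g
  refine ⟨fun k => Nat.rec 0 (fun i r => g i + x i * r) k, ?_⟩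
  funext i
  simp [diffOp]

/-- The coefficients have period `n`, so the operator commutes with the shift by `n` and preserves
multipliers. -/
theorem diffOp_quasi {x : ZMod n → ℝ} {f : ℕ → ℝ} {c : ℝ} (hf : ∀ i, f (i + n) = c * f i) (i : ℕ) :
    diffOp x f (i + n) = c * diffOp x f i := by
  have h1 := hf (i + 1)
  rw [add_right_comm] at h1
  simp only [diffOp, hf, h1]
  push_cast
  rw [ZMod.natCast_self, add_zero]
  ring

theorem Exch.ker {x y y' x' : ZMod n → ℝ} (h : Exch x y y' x') {f : ℕ → ℝ}
    (hf : diffOp x' f = 0) : diffOp x (diffOp y f) = 0 := by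
  rw [h.diffOp_eq, hf, diffOp_zero]

theorem Exch.diffOp₂_of_ker {y z x₁ x₂ z₁ : ZMod n → ℝ} (h2 : Exch x₁ z z₁ x₂) {f : ℕ → ℝ} (hf : diffOp x₂ f = 0) (i : ℕ) :
    diffOp y (diffOp z f) i = (x₁ i - y i) * ((x₂ i - z i) * f i) := by
  rw [diffOp_of_ker (h2.ker hf), diffOp_of_ker hf]

variable [NeZero n]

theorem prod_range_window (f : ZMod n → ℝ) (i : ZMod n) :
    ∏ j ∈ Finset.range n, f (i + (j : ZMod n)) = ∏ a, f a := by
  have h0 : ∏ j ∈ Finset.range n, f (i + (j : ZMod n)) = ∏ a, f (i + a) := by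
    refine Finset.prod_nbij' (fun j => (j : ZMod n)) (fun a => a.val) ?_ ?_ ?_ ?_ ?_
    · simp
    · intro a _
      exact Finset.mem_range.2 (ZMod.val_lt a)
    · intro j hj
      exact ZMod.val_cast_of_lt (Finset.mem_range.1 hj)
    · intro a _
      exact ZMod.natCast_zmod_val a
    · simp
  rw [h0]
  exact Equiv.prod_comp (Equiv.addLeft i) f

theorem quasi_of_ker {x : ZMod n → ℝ} {f : ℕ → ℝ} (hf : diffOp x f = 0) (i : ℕ) :
    f (i + n) = (∏ a, x a) * f i := by
  have h : ∀ k, f (i + k) = (∏ j ∈ Finset.range k, x ((i : ZMod n) + (j : ZMod n))) * f i := by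
    intro k
    induction k with
    | zero => simp
    | succ k ih =>
      have := congrFun hf (i + k)
      simp only [diffOp, Pi.zero_apply] at this
      push_cast at this
      rw [Finset.prod_range_succ, ← add_assoc]
      linear_combination this + x ((i : ZMod n) + (k : ZMod n)) * ih
  rw [h, prod_range_window]

/-- The only multiplier of a nonzero kernel sequence is the product of the coefficients. -/
theorem eq_zero_of_ker_of_quasi {x : ZMod n → ℝ} {f : ℕ → ℝ} {c : ℝ} (hc : ∏ a, x a ≠ c)
    (hf : diffOp x f = 0) (hq : ∀ i, f (i + n) = c * f i) : f = 0 := by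
  funext i
  have h := quasi_of_ker hf i
  rw [hq] at h
  by_contra h0
  exact hc (mul_right_cancel₀ h0 h.symm)

theorem eq_of_ker {x y : ZMod n → ℝ} {f : ℕ → ℝ} (hf : diffOp x f = 0) (h0 : ∀ i, f i ≠ 0)
    (hy : diffOp y f = 0) : x = y := by
  funext i
  have h := diffOp_of_ker (y := y) hf i.val
  rw [hy, ZMod.natCast_zmod_val] at h
  have := (mul_eq_zero.1 h.symm).resolve_right (h0 _)
  linarith

theorem eq_of_diffOp_eq {x y : ZMod n → ℝ} (h : diffOp x = diffOp y) (hx : ∀ i, x i ≠ 0) :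
    x = y :=
  eq_of_ker (diffOp_kerSeq x) (kerSeq_ne_zero hx) (by rw [← h, diffOp_kerSeq])

/-- Let `k` span the kernel of `diffOp x`. Then `diffOp x' k` is killed by `diffOp y'` but has
multiplier `∏ x ≠ ∏ y'`, so it vanishes and `x' = x`. The right factor is surjective and cancels. -/
theorem factorization_unique₂ {x y x' y' : ZMod n → ℝ}
    (h : ∀ f, diffOp y (diffOp x f) = diffOp y' (diffOp x' f))
    (hx : ∀ i, x i ≠ 0) (hy : ∀ i, y i ≠ 0) (hX : ∏ a, x' a = ∏ a, x a)
    (hXY : ∏ a, y' a ≠ ∏ a, x a) : y = y' ∧ x = x' := by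
  have hk := diffOp_kerSeq x
  have h1 : diffOp y' (diffOp x' (kerSeq x)) = 0 := by rw [← h, hk, diffOp_zero]
  have h2 := eq_zero_of_ker_of_quasi hXY h1 (diffOp_quasi (quasi_of_ker hk))
  have h3 : x = x' := eq_of_ker hk (kerSeq_ne_zero hx) h2
  subst h3
  refine ⟨eq_of_diffOp_eq (funext fun g => ?_) hy, rfl⟩
  obtain ⟨f, rfl⟩ := diffOp_surjective x g
  exact h f

theorem factorization_unique₃ {x y z x' y' z' : ZMod n → ℝ}
    (h : ∀ f, diffOp z (diffOp y (diffOp x f)) = diffOp z' (diffOp y' (diffOp x' f)))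
    (hx : ∀ i, x i ≠ 0) (hy : ∀ i, y i ≠ 0) (hz : ∀ i, z i ≠ 0)
    (hX : ∏ a, x' a = ∏ a, x a) (hY : ∏ a, y' a = ∏ a, y a)
    (hXY : ∏ a, y' a ≠ ∏ a, x a) (hXZ : ∏ a, z' a ≠ ∏ a, x a) (hYZ : ∏ a, z' a ≠ ∏ a, y a) :
    z = z' ∧ y = y' ∧ x = x' := by
  have hk := diffOp_kerSeq x
  have h1 : diffOp z' (diffOp y' (diffOp x' (kerSeq x))) = 0 := by
    rw [← h, hk, diffOp_zero, diffOp_zero]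
  have h2 := eq_zero_of_ker_of_quasi hXZ h1 (diffOp_quasi (diffOp_quasi (quasi_of_ker hk)))
  have h3 := eq_zero_of_ker_of_quasi hXY h2 (diffOp_quasi (quasi_of_ker hk))
  have h4 : x = x' := eq_of_ker hk (kerSeq_ne_zero hx) h3
  subst h4
  have h5 := factorization_unique₂ (x := y) (y := z) (x' := y') (y' := z') (fun g => by
    obtain ⟨f, rfl⟩ := diffOp_surjective x g
    exact h f) hy hz hY hYZ
  exact ⟨h5.1, h5.2, rfl⟩

theorem Exch.unique {x y u v u' v' : ZMod n → ℝ} (h : Exch x y u v) (h' : Exch x y u' v')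
    (hu : ∀ i, u i ≠ 0) (hv : ∀ i, v i ≠ 0) (hV : ∏ a, v' a = ∏ a, v a)
    (hUV : ∏ a, u' a ≠ ∏ a, v a) : u = u' ∧ v = v' :=
  factorization_unique₂ (fun f => by rw [← h.diffOp_eq, h'.diffOp_eq]) hv hu hV hUV

/-- The Yang–Baxter equation for solutions of the exchange relations. -/
theorem Exch.yangBaxter {x y z x₁ y₁ z₁ x₂ y₂ z₂ x₁' y₁' z₁' x₂' y₂' z₂' : ZMod n → ℝ}
    (h1 : Exch x y y₁ x₁) (h2 : Exch x₁ z z₁ x₂) (h3 : Exch y₁ z₁ z₂ y₂)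
    (h1' : Exch y z z₁' y₁') (h2' : Exch x z₁' z₂' x₁') (h3' : Exch x₁' y₁' y₂' x₂')
    (hx : ∀ i, x₂ i ≠ 0) (hy : ∀ i, y₂ i ≠ 0) (hz : ∀ i, z₂ i ≠ 0)
    (hX : ∏ a, x₂' a = ∏ a, x₂ a) (hY : ∏ a, y₂' a = ∏ a, y₂ a)
    (hXY : ∏ a, y₂' a ≠ ∏ a, x₂ a) (hXZ : ∏ a, z₂' a ≠ ∏ a, x₂ a)
    (hYZ : ∏ a, z₂' a ≠ ∏ a, y₂ a) :
    z₂ = z₂' ∧ y₂ = y₂' ∧ x₂ = x₂' := by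
  refine factorization_unique₃ (fun f => ?_) hx hy hz hX hY hXY hXZ hYZ
  -- Both triple products are refactorizations of `diffOp x ∘ diffOp y ∘ diffOp z`.
  rw [← h3.diffOp_eq, ← h2.diffOp_eq, h1.symm.diffOp_eq, h1'.diffOp_eq, h2'.diffOp_eq,
    h3'.diffOp_eq]

/-- The energy of the first factor in the Yang–Baxter equation. -/
theorem Exch.energy_left {y z x₁ z₁ x₂ x₁' y₁' z₁' y₂' : ZMod n → ℝ}
    (h2 : Exch x₁ z z₁ x₂) (h1' : Exch y z z₁' y₁') (h3' : Exch x₁' y₁' y₂' x₂)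
    (hx : ∀ i, x₂ i ≠ 0) (i : ZMod n) :
    (x₁ i - y i) * (x₂ i - z i) = (x₁' i - z₁' i) * (x₂ i - y₁' i) := by
  -- Apply the two factorizations of `diffOp y ∘ diffOp z` to the kernel of `diffOp x₂` and compare
  -- multipliers.
  have e1 := h2.diffOp₂_of_ker (y := y) (diffOp_kerSeq x₂) i.val
  have e2 := h3'.diffOp₂_of_ker (y := z₁') (diffOp_kerSeq x₂) i.val
  rw [h1'.diffOp_eq, e2, ZMod.natCast_zmod_val, ← mul_assoc, ← mul_assoc] at e1
  exact (mul_right_cancel₀ (kerSeq_ne_zero hx _) e1).symm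

/-- The energy of the last factor in the Yang–Baxter equation. -/
theorem Exch.energy_right {x y z x₁ y₁ z₁ x₂ y₂ z₂ x₁' y₁' z₁' : ZMod n → ℝ}
    (h2 : Exch x₁ z z₁ x₂) (h3 : Exch y₁ z₁ z₂ y₂)
    (h1' : Exch y z z₁' y₁') (h2' : Exch x z₁' z₂ x₁') (h3' : Exch x₁' y₁' y₂ x₂)
    (hz : ∀ i, z i ≠ 0) (i : ZMod n) :
    (x₁ i - z₁ i) * (y₁ i - z₂ i) = (y i - z₁' i) * (x i - z₂ i) := by
  -- The reversed system exchanges the roles of `x` and `z`. Taken at `i + 1`, its differences turn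
  -- into those at `i` by the additive exchange relations.
  have e := h2.symm.energy_left h3'.symm h1'.symm hz (i + 1)
  rw [show z₁ (i + 1) - y₂ (i + 1) = z₂ i - y₁ i by linear_combination (h3 i).2,
    show z (i + 1) - x₂ (i + 1) = z₁ i - x₁ i by linear_combination (h2 i).2,
    show z₁' (i + 1) - x₁' (i + 1) = z₂ i - x i by linear_combination (h2' i).2,
    show z (i + 1) - y₁' (i + 1) = z₁' i - y i by linear_combination (h1' i).2] at e
  linear_combination e

/-! ### The mixed Yang–Baxter equation

A dotted array `z` enters through the inverse of `diffOp (-z)`. -/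

/-- On the kernel of `diffOp (-z)`, the two factorizations of `diffOp x ∘ diffOp y` have multipliers
that are products of sums, whence the energy identity. The resulting sequence vanishes nowhere and
is killed by both `diffOp (-z₂)` and `diffOp (-z₂')`, so these agree. -/
theorem Exch.mixed_last {x y z x₁ y₁ z₁ x₂ y₂ z₂ x₁' y₁' z₁' z₂' : ZMod n → ℝ}
    (h1 : Exch x y y₁ x₁) (h2 : Exch (-z₁) x₁ x₂ (-z)) (h3 : Exch (-z₂) y₁ y₂ (-z₁))
    (h1' : Exch (-z₁') y y₁' (-z)) (h2' : Exch (-z₂') x x₁' (-z₁'))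
    (hz : ∀ i, z i ≠ 0) (hyz : ∀ i, y i + z i ≠ 0) (hxz : ∀ i, x i + z₁' i ≠ 0) :
    z₂ = z₂' ∧ ∀ i, (x i + z₁' i) * (y i + z i) = (y₁ i + z₁ i) * (x₁ i + z i) := by
  set f := kerSeq (-z) with hf
  have hk : diffOp (-z) f = 0 := diffOp_kerSeq _
  have hf0 : ∀ i, f i ≠ 0 := kerSeq_ne_zero fun i => neg_ne_zero.2 (hz i)
  have a1 : diffOp (-z₁') (diffOp y f) = 0 := h1'.ker hk
  have a2 : diffOp (-z₁) (diffOp x₁ f) = 0 := h2.ker hk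
  have b1 : ∀ i : ℕ, diffOp x (diffOp y f) i = (x i + z₁' i) * (y i + z i) * f i := by
    intro i
    rw [diffOp_of_ker a1, diffOp_of_ker hk]
    simp only [Pi.neg_apply]
    ring
  have b2 : ∀ i : ℕ, diffOp y₁ (diffOp x₁ f) i = (y₁ i + z₁ i) * (x₁ i + z i) * f i := by
    intro i
    rw [diffOp_of_ker a2, diffOp_of_ker hk]
    simp only [Pi.neg_apply]
    ring
  rw [← h1.diffOp_eq] at b2
  constructor
  · have c1 : diffOp (-z₂) (diffOp x (diffOp y f)) = 0 := by
      rw [h1.diffOp_eq]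
      exact h3.ker a2
    have c2 : diffOp (-z₂') (diffOp x (diffOp y f)) = 0 := h2'.ker a1
    exact neg_injective (eq_of_ker c1 (fun i => by
      rw [b1]
      exact mul_ne_zero (mul_ne_zero (hxz _) (hyz _)) (hf0 i)) c2)
  · intro i
    have := b1 i.val
    rw [b2, ZMod.natCast_zmod_val] at this
    exact (mul_right_cancel₀ (hf0 _) this).symm

/-- Pulling `diffOp (-z)` to the left through either factorization gives `diffOp (-z₂) ∘ diffOp x ∘
diffOp y`. The surjective `diffOp (-z)` cancels, leaving two factorizations of one second-order
operator. -/
theorem Exch.mixed_solid {x y z x₁ y₁ z₁ x₂ y₂ z₂ x₁' y₁' z₁' x₂' y₂' : ZMod n → ℝ}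
    (h1 : Exch x y y₁ x₁) (h2 : Exch (-z₁) x₁ x₂ (-z)) (h3 : Exch (-z₂) y₁ y₂ (-z₁))
    (h1' : Exch (-z₁') y y₁' (-z)) (h2' : Exch (-z₂) x x₁' (-z₁')) (h3' : Exch x₁' y₁' y₂' x₂')
    (hx : ∀ i, x₂ i ≠ 0) (hy : ∀ i, y₂ i ≠ 0) (hX : ∏ a, x₂' a = ∏ a, x₂ a)
    (hXY : ∏ a, y₂' a ≠ ∏ a, x₂ a) : y₂ = y₂' ∧ x₂ = x₂' := by
  refine factorization_unique₂ (fun g => ?_) hx hy hX hXY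
  obtain ⟨f, rfl⟩ := diffOp_surjective (-z) g
  rw [← h2.diffOp_eq, ← h3.diffOp_eq, h1.symm.diffOp_eq, ← h3'.diffOp_eq, ← h1'.diffOp_eq,
    ← h2'.diffOp_eq]

/-- Here the multipliers of the two sides of `h1'` are compared on the kernel of `diffOp x₁`. -/
theorem Exch.mixed_energy {x y z x₁ y₁ z₁ x₂ y₁' z₁' : ZMod n → ℝ}
    (h1 : Exch x y y₁ x₁) (h2 : Exch (-z₁) x₁ x₂ (-z)) (h1' : Exch (-z₁') y y₁' (-z))
    (hx : ∀ i, x₁ i ≠ 0) (i : ZMod n) :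
    (x i + z₁' i) * (x₁ i - y i) = (x₂ i - y₁' i) * (x₁ i + z i) := by
  set f := kerSeq x₁ with hf
  have hk : diffOp x₁ f = 0 := diffOp_kerSeq _
  have hf0 : ∀ i, f i ≠ 0 := kerSeq_ne_zero hx
  have a1 : diffOp x (diffOp y f) = 0 := h1.ker hk
  have a2 : diffOp x₂ (diffOp (-z) f) = 0 := h2.symm.ker hk
  have b1 := diffOp_of_ker (y := -z₁') a1 i.val
  rw [h1'.diffOp_eq, diffOp_of_ker a2, diffOp_of_ker hk, diffOp_of_ker hk] at b1
  simp only [ZMod.natCast_zmod_val, Pi.neg_apply] at b1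
  refine mul_right_cancel₀ (hf0 i.val) ?_
  linear_combination -b1

end Factorization

section Lift

/-! ### The lift of the combinatorial `R` -/

variable {n : ℕ}

/-- The lift of `Q`. -/
def gQ (x y : ZMod n → ℝ) (i : ZMod n) : ℝ :=
  ∑ k ∈ Finset.Icc 1 n, (∏ j ∈ Finset.Ico 1 k, x (i + (j : ZMod n)))
    * ∏ j ∈ Finset.Ioc k n, y (i + (j : ZMod n))

/-- The lift of `P`. -/
def gP (x y : ZMod n → ℝ) (i : ZMod n) : ℝ := x (i + 1) + y (i + 1)

/-- The lift of `upQ`. -/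
noncomputable def gUp (x y : ZMod n → ℝ) (i : ZMod n) : ℝ := x i * gQ x y i / gQ x y (i - 1)

/-- The lift of `downQ`. -/
noncomputable def gDown (x y : ZMod n → ℝ) (i : ZMod n) : ℝ := y i * gQ x y (i - 1) / gQ x y i

/-- The lift of `shiftP`. -/
noncomputable def gShift (x y : ZMod n → ℝ) (i : ZMod n) : ℝ := x i * gP x y i / gP x y (i - 1)

theorem prod_pred_window [NeZero n] (f : ZMod n → ℝ) (i : ZMod n) :
    ∏ j ∈ Finset.Ioc 0 n, f (i + (j : ZMod n)) = ∏ a, f a := by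
  rw [← prod_range_window f (i + 1), Finset.range_eq_Ico]
  have e : Finset.Ioc 0 n = Finset.Ico (0 + 1) (n + 1) := by
    ext j
    simp only [Finset.mem_Ioc, Finset.mem_Ico]
    omega
  rw [e, ← Finset.prod_Ico_add' (fun j : ℕ => f (i + (j : ZMod n))) 0 n 1]
  refine Finset.prod_congr rfl fun j _ => ?_
  congr 1
  push_cast
  ring

theorem prod_Ico_shift (f : ZMod n → ℝ) (i : ZMod n) {k : ℕ} (hk : 1 ≤ k) :
    ∏ j ∈ Finset.Ico 1 (k + 1), f (i + (j : ZMod n))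
      = f (i + 1) * ∏ j ∈ Finset.Ico 1 k, f (i + 1 + (j : ZMod n)) := by
  rw [Finset.prod_eq_prod_Ico_succ_bot (by omega),
    ← Finset.prod_Ico_add' (fun j : ℕ => f (i + (j : ZMod n))) 1 k 1]
  congr 1
  · simp
  · refine Finset.prod_congr rfl fun j _ => ?_
    congr 1
    push_cast
    ring

theorem prod_Ioc_shift (f : ZMod n → ℝ) (i : ZMod n) {k : ℕ} (hk : k < n) :
    (∏ j ∈ Finset.Ioc (k + 1) n, f (i + (j : ZMod n))) * f (i + 1)
      = ∏ j ∈ Finset.Ioc k n, f (i + 1 + (j : ZMod n)) := by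
  have h : f (i + 1) = f (i + ((n + 1 : ℕ) : ZMod n)) := by simp
  have e : ∀ a b : ℕ, Finset.Ioc a b = Finset.Ico (a + 1) (b + 1) := by
    intro a b
    ext j
    simp only [Finset.mem_Ioc, Finset.mem_Ico]
    omega
  rw [h, ← Finset.prod_Ioc_succ_top (f := fun j : ℕ => f (i + (j : ZMod n))) (by omega), e, e,
    ← Finset.prod_Ico_add' (fun j : ℕ => f (i + (j : ZMod n))) (k + 1) (n + 1) 1]
  refine Finset.prod_congr rfl fun j _ => ?_
  congr 1
  push_cast
  ring

/-- A telescoping identity: the two products are sums of consecutive terms of one sequence, shifted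
by one step. -/
theorem gQ_succ [NeZero n] (x y : ZMod n → ℝ) (i : ZMod n) :
    x (i + 1) * gQ x y (i + 1) - y (i + 1) * gQ x y i = ∏ a, x a - ∏ a, y a := by
  -- `A k` has `k` factors from `x` and `n - k` from `y`, so it runs from `∏ y` to `∏ x`.
  set A : ℕ → ℝ := fun k => (∏ j ∈ Finset.Ico 1 (k + 1), x (i + (j : ZMod n)))
    * ∏ j ∈ Finset.Ioc k n, y (i + 1 + (j : ZMod n)) with hA
  have h1 : x (i + 1) * gQ x y (i + 1) = ∑ k ∈ Finset.range n, A (k + 1) := by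
    rw [gQ, Finset.mul_sum, Finset.range_eq_Ico, Finset.sum_Ico_add' A 0 n 1]
    refine Finset.sum_congr (by ext; simp only [Finset.mem_Icc, Finset.mem_Ico]; omega) fun k hk => ?_
    rw [Finset.mem_Ico] at hk
    simp only [hA]
    rw [prod_Ico_shift x i (by omega)]
    ring
  have h2 : y (i + 1) * gQ x y i = ∑ k ∈ Finset.range n, A k := by
    have e : Finset.Icc 1 n = Finset.Ico (0 + 1) (n + 1) := by
      ext
      simp only [Finset.mem_Icc, Finset.mem_Ico]
      omega
    rw [gQ, Finset.mul_sum, e, Finset.range_eq_Ico, ← Finset.sum_Ico_add' _ 0 n 1]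
    refine Finset.sum_congr rfl fun k hk => ?_
    rw [Finset.mem_Ico] at hk
    simp only [hA]
    rw [← prod_Ioc_shift y i (k := k) (by omega)]
    ring
  have h3 : A n = ∏ a, x a := by
    simp only [hA, Finset.Ioc_self, Finset.prod_empty, mul_one]
    rw [← prod_pred_window x i]
    rfl
  have h4 : A 0 = ∏ a, y a := by
    simp only [hA, zero_add, Finset.Ico_self, Finset.prod_empty, one_mul]
    exact prod_pred_window y (i + 1)
  have h5 := Finset.sum_range_succ A n
  have h6 := Finset.sum_range_succ' A n
  rw [h1, h2, ← h3, ← h4]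
  linarith

theorem gQ_pred [NeZero n] (x y : ZMod n → ℝ) (i : ZMod n) :
    x i * gQ x y i - y i * gQ x y (i - 1) = ∏ a, x a - ∏ a, y a := by
  have := gQ_succ x y (i - 1)
  rwa [sub_add_cancel] at this

theorem gQ_pos [NeZero n] {x y : ZMod n → ℝ} (hx : ∀ i, 0 < x i) (hy : ∀ i, 0 < y i) (i : ZMod n) :
    0 < gQ x y i :=
  Finset.sum_pos (fun _ _ => mul_pos (Finset.prod_pos fun _ _ => hx _)
    (Finset.prod_pos fun _ _ => hy _)) (Finset.nonempty_Icc.2 NeZero.one_le)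

theorem gP_pos {x y : ZMod n → ℝ} (hx : ∀ i, 0 < x i) (hy : ∀ i, 0 < y i) (i : ZMod n) :
    0 < gP x y i := add_pos (hx _) (hy _)

theorem gP_comm (x y : ZMod n → ℝ) (i : ZMod n) : gP x y i = gP y x i := add_comm _ _

theorem gUp_pos [NeZero n] {x y : ZMod n → ℝ} (hx : ∀ i, 0 < x i) (hy : ∀ i, 0 < y i)
    (i : ZMod n) : 0 < gUp x y i :=
  div_pos (mul_pos (hx i) (gQ_pos hx hy _)) (gQ_pos hx hy _)

theorem gDown_pos [NeZero n] {x y : ZMod n → ℝ} (hx : ∀ i, 0 < x i) (hy : ∀ i, 0 < y i)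
    (i : ZMod n) : 0 < gDown x y i :=
  div_pos (mul_pos (hy i) (gQ_pos hx hy _)) (gQ_pos hx hy _)

theorem gShift_pos {x y : ZMod n → ℝ} (hx : ∀ i, 0 < x i) (hy : ∀ i, 0 < y i)
    (i : ZMod n) : 0 < gShift x y i :=
  div_pos (mul_pos (hx i) (gP_pos hx hy _)) (gP_pos hx hy _)

/-- This and `gUp_sub` convert differences of coefficients into energies. The numerator does not
depend on `i` and later cancels. -/
theorem sub_gDown [NeZero n] {x y : ZMod n → ℝ} (hx : ∀ i, 0 < x i) (hy : ∀ i, 0 < y i)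
    (i : ZMod n) : x i - gDown x y i = (∏ a, x a - ∏ a, y a) / gQ x y i := by
  have := (gQ_pos hx hy i).ne'
  rw [gDown, ← gQ_pred x y i]
  field_simp

theorem gUp_sub [NeZero n] {x y : ZMod n → ℝ} (hx : ∀ i, 0 < x i) (hy : ∀ i, 0 < y i)
    (i : ZMod n) : gUp x y i - y i = (∏ a, x a - ∏ a, y a) / gQ x y (i - 1) := by
  have := (gQ_pos hx hy (i - 1)).ne'
  rw [gUp, ← gQ_pred x y i]
  field_simp

theorem exch_gQ [NeZero n] {x y : ZMod n → ℝ} (hx : ∀ i, 0 < x i) (hy : ∀ i, 0 < y i) :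
    Exch x y (gDown x y) (gUp x y) := by
  intro i
  constructor
  · have h1 := (gQ_pos hx hy (i - 1)).ne'
    have h2 := (gQ_pos hx hy i).ne'
    simp only [gDown, gUp]
    field_simp
  · have h1 := sub_gDown hx hy i
    have h2 := gUp_sub hx hy (i + 1)
    rw [add_sub_cancel_right] at h2
    linarith

theorem prod_mul_div_shift [NeZero n] {f g : ZMod n → ℝ} (hg : ∀ i, g i ≠ 0) :
    ∏ i, f i * g i / g (i - 1) = ∏ i, f i := by
  have h : ∏ i, g (i - 1) = ∏ i, g i := Equiv.prod_comp (Equiv.subRight (1 : ZMod n)) g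
  rw [Finset.prod_div_distrib, Finset.prod_mul_distrib, h,
    mul_div_cancel_right₀ _ (Finset.prod_ne_zero_iff.2 fun i _ => hg i)]

theorem prod_gUp [NeZero n] {x y : ZMod n → ℝ} (hx : ∀ i, 0 < x i) (hy : ∀ i, 0 < y i) :
    ∏ i, gUp x y i = ∏ i, x i := prod_mul_div_shift fun i => (gQ_pos hx hy i).ne'

theorem prod_gShift [NeZero n] {x y : ZMod n → ℝ} (hx : ∀ i, 0 < x i) (hy : ∀ i, 0 < y i) :
    ∏ i, gShift x y i = ∏ i, x i := prod_mul_div_shift fun i => (gP_pos hx hy i).ne'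

theorem prod_gDown [NeZero n] {x y : ZMod n → ℝ} (hx : ∀ i, 0 < x i) (hy : ∀ i, 0 < y i) :
    ∏ i, gDown x y i = ∏ i, y i := by
  have h : ∏ i, gQ x y (i - 1) = ∏ i, gQ x y i :=
    Equiv.prod_comp (Equiv.subRight (1 : ZMod n)) (gQ x y)
  simp only [gDown]
  rw [Finset.prod_div_distrib, Finset.prod_mul_distrib, h,
    mul_div_cancel_right₀ _ (Finset.prod_ne_zero_iff.2 fun i _ => (gQ_pos hx hy i).ne')]

theorem gShift_add_gShift {x y : ZMod n → ℝ} (hx : ∀ i, 0 < x i) (hy : ∀ i, 0 < y i)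
    (i : ZMod n) : gShift x y i + gShift y x i = gP x y i := by
  have h : gP x y (i - 1) = x i + y i := by simp [gP]
  have h0 : x i + y i ≠ 0 := (add_pos (hx i) (hy i)).ne'
  rw [gShift, gShift, gP_comm y x, gP_comm y x, h]
  field_simp

/-- With the dotted array negated, the lifted `R^∨` is a refactorization too: `gShift` keeps ratios
at each index and replaces the sum at `i` by the sum at `i + 1`. -/
theorem exch_gP {x y : ZMod n → ℝ} (hx : ∀ i, 0 < x i) (hy : ∀ i, 0 < y i) :
    Exch (-gShift y x) x (gShift x y) (-y) := by
  intro i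
  simp only [Pi.neg_apply]
  constructor
  · simp only [gShift, gP_comm y x]
    ring
  · have h1 := gShift_add_gShift hx hy i
    have h2 : gP x y i = x (i + 1) + y (i + 1) := rfl
    linarith

end Lift

/-! ### Yang–Baxter equations for the lifted maps -/

section LiftedYangBaxter

variable {n : ℕ} [NeZero n] {x y z : ZMod n → ℝ}

/-- The lift of the Yang–Baxter equation for three solid arrays. -/
theorem gYangBaxter (hx : ∀ i, 0 < x i) (hy : ∀ i, 0 < y i) (hz : ∀ i, 0 < z i)
    (hXY : ∏ a, x a ≠ ∏ a, y a) (hXZ : ∏ a, x a ≠ ∏ a, z a) (hYZ : ∏ a, y a ≠ ∏ a, z a) :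
    let y₁ := gDown x y
    let x₁ := gUp x y
    let z₁ := gDown x₁ z
    let z₁' := gDown y z
    let y₁' := gUp y z
    let x₁' := gUp x z₁'
    gDown y₁ z₁ = gDown x z₁' ∧ gUp y₁ z₁ = gDown x₁' y₁' ∧ gUp x₁ z = gUp x₁' y₁' ∧
    (∀ i, gQ x y i * gQ x₁ z i = gQ x z₁' i * gQ x₁' y₁' i) ∧
    ∀ i, gQ x₁ z i * gQ y₁ z₁ i = gQ y z i * gQ x z₁' i := by
  intro y₁ x₁ z₁ z₁' y₁' x₁'
  have py₁ : ∀ i, 0 < y₁ i := gDown_pos hx hy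
  have px₁ : ∀ i, 0 < x₁ i := gUp_pos hx hy
  have pz₁ : ∀ i, 0 < z₁ i := gDown_pos px₁ hz
  have pz₁' : ∀ i, 0 < z₁' i := gDown_pos hy hz
  have py₁' : ∀ i, 0 < y₁' i := gUp_pos hy hz
  have px₁' : ∀ i, 0 < x₁' i := gUp_pos hx pz₁'
  have Ey₁ : ∏ a, y₁ a = ∏ a, y a := prod_gDown hx hy
  have Ex₁ : ∏ a, x₁ a = ∏ a, x a := prod_gUp hx hy
  have Ez₁ : ∏ a, z₁ a = ∏ a, z a := prod_gDown px₁ hz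
  have Ez₁' : ∏ a, z₁' a = ∏ a, z a := prod_gDown hy hz
  have Ey₁' : ∏ a, y₁' a = ∏ a, y a := prod_gUp hy hz
  have Ex₁' : ∏ a, x₁' a = ∏ a, x a := prod_gUp hx pz₁'
  have h1 := exch_gQ hx hy
  have h2 := exch_gQ px₁ hz
  have h3 := exch_gQ py₁ pz₁
  have h1' := exch_gQ hy hz
  have h2' := exch_gQ hx pz₁'
  have h3' := exch_gQ px₁' py₁'
  obtain ⟨ez, ey, ex⟩ := Exch.yangBaxter h1 h2 h3 h1' h2' h3' (fun i => (gUp_pos px₁ hz i).ne')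
    (fun i => (gUp_pos py₁ pz₁ i).ne') (fun i => (gDown_pos py₁ pz₁ i).ne')
    (by rw [prod_gUp px₁' py₁', prod_gUp px₁ hz, Ex₁, Ex₁'])
    (by rw [prod_gDown px₁' py₁', prod_gUp py₁ pz₁, Ey₁, Ey₁'])
    (by rw [prod_gDown px₁' py₁', prod_gUp px₁ hz, Ex₁, Ey₁']; exact hXY.symm)
    (by rw [prod_gDown hx pz₁', prod_gUp px₁ hz, Ex₁, Ez₁']; exact hXZ.symm)
    (by rw [prod_gDown hx pz₁', prod_gUp py₁ pz₁, Ey₁, Ez₁']; exact hYZ.symm)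
  have n1 := sub_ne_zero.2 hXY
  have n2 := sub_ne_zero.2 hXZ
  have n3 := sub_ne_zero.2 hYZ
  refine ⟨ez, ey, ex, fun i => ?_, fun i => ?_⟩
  -- The index is `i + 1` because `gUp_sub` gives `gQ` at the preceding index.
  · have e := h2.energy_left h1' (ex ▸ h3') (fun i => (gUp_pos px₁ hz i).ne') (i + 1)
    rw [gUp_sub hx hy, gUp_sub px₁ hz, ex, gUp_sub px₁' py₁', gUp_sub hx pz₁', Ex₁, Ex₁',
      Ez₁', Ey₁', add_sub_cancel_right] at e
    have a1 := (gQ_pos hx hy i).ne'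
    have a2 := (gQ_pos px₁ hz i).ne'
    have a3 := (gQ_pos hx pz₁' i).ne'
    have a4 := (gQ_pos px₁' py₁' i).ne'
    rw [div_mul_div_comm, div_mul_div_comm, div_eq_div_iff (mul_ne_zero a1 a2)
      (mul_ne_zero a3 a4)] at e
    refine mul_left_cancel₀ (mul_ne_zero n1 n2) ?_
    linear_combination -e
  · have e := Exch.energy_right h2 h3 h1' (ez ▸ h2') (by
      rw [ey, ex]
      exact h3') (fun i => (hz i).ne') i
    rw [sub_gDown px₁ hz, sub_gDown py₁ pz₁, ez, sub_gDown hy hz, sub_gDown hx pz₁', Ex₁,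
      Ey₁, Ez₁, Ez₁'] at e
    have a1 := (gQ_pos px₁ hz i).ne'
    have a2 := (gQ_pos py₁ pz₁ i).ne'
    have a3 := (gQ_pos hy hz i).ne'
    have a4 := (gQ_pos hx pz₁' i).ne'
    rw [div_mul_div_comm, div_mul_div_comm, div_eq_div_iff (mul_ne_zero a1 a2)
      (mul_ne_zero a3 a4)] at e
    refine mul_left_cancel₀ (mul_ne_zero n2 n3) ?_
    linear_combination -e

/-- The lift of the Yang–Baxter equation for two solid arrays and a dotted one. -/
theorem gMixedYangBaxter (hx : ∀ i, 0 < x i) (hy : ∀ i, 0 < y i) (hz : ∀ i, 0 < z i)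
    (hXY : ∏ a, x a ≠ ∏ a, y a) :
    let y₁ := gDown x y
    let x₁ := gUp x y
    let z₁ := gShift z x₁
    let z₁' := gShift z y
    let y₁' := gShift y z
    let x₁' := gShift x z₁'
    gShift z₁ y₁ = gShift z₁' x ∧ gShift y₁ z₁ = gDown x₁' y₁' ∧ gShift x₁ z = gUp x₁' y₁' ∧
    (∀ i, gQ x y i * gP x₁ z i = gP x z₁' i * gQ x₁' y₁' i) ∧
    ∀ i, gP x₁ z i * gP y₁ z₁ i = gP y z i * gP x z₁' i := by
  intro y₁ x₁ z₁ z₁' y₁' x₁'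
  have py₁ : ∀ i, 0 < y₁ i := gDown_pos hx hy
  have px₁ : ∀ i, 0 < x₁ i := gUp_pos hx hy
  have pz₁ : ∀ i, 0 < z₁ i := gShift_pos hz px₁
  have pz₁' : ∀ i, 0 < z₁' i := gShift_pos hz hy
  have py₁' : ∀ i, 0 < y₁' i := gShift_pos hy hz
  have px₁' : ∀ i, 0 < x₁' i := gShift_pos hx pz₁'
  have Ex₁ : ∏ a, x₁ a = ∏ a, x a := prod_gUp hx hy
  have Ey₁' : ∏ a, y₁' a = ∏ a, y a := prod_gShift hy hz
  have Ex₁' : ∏ a, x₁' a = ∏ a, x a := prod_gShift hx pz₁'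
  have h1 := exch_gQ hx hy
  have h2 := exch_gP px₁ hz
  have h3 := exch_gP py₁ pz₁
  have h1' := exch_gP hy hz
  have h2' := exch_gP hx pz₁'
  have h3' := exch_gQ px₁' py₁'
  obtain ⟨ez, eP⟩ := Exch.mixed_last h1 h2 h3 h1' h2' (fun i => (hz i).ne')
    (fun i => (add_pos (hy i) (hz i)).ne') (fun i => (add_pos (hx i) (pz₁' i)).ne')
  obtain ⟨ey, ex⟩ := Exch.mixed_solid h1 h2 h3 h1' (ez ▸ h2') h3'
    (fun i => (gShift_pos px₁ hz i).ne') (fun i => (gShift_pos py₁ pz₁ i).ne')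
    (by rw [prod_gUp px₁' py₁', prod_gShift px₁ hz, Ex₁, Ex₁'])
    (by rw [prod_gDown px₁' py₁', prod_gShift px₁ hz, Ex₁, Ey₁']; exact hXY.symm)
  refine ⟨ez, ey, ex, fun i => ?_, fun i => ?_⟩
  · have e := h1.mixed_energy h2 h1' (fun i => (px₁ i).ne') (i + 1)
    rw [gUp_sub hx hy, ex, gUp_sub px₁' py₁', Ex₁', Ey₁', add_sub_cancel_right] at e
    have a1 := (gQ_pos hx hy i).ne'
    have a2 := (gQ_pos px₁' py₁' i).ne'
    rw [mul_div_assoc', div_mul_eq_mul_div, div_eq_div_iff a1 a2] at e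
    refine mul_left_cancel₀ (sub_ne_zero.2 hXY) ?_
    simp only [gP]
    linear_combination -e
  · have := eP (i + 1)
    simp only [gP]
    linear_combination -this

end LiftedYangBaxter

section LiftedReflection

/-! ### The lift of the reflection equation -/

variable {n : ℕ}

/-- This and the next lemma handle the quadratic numerators produced by the switches. -/
theorem Exch.mul_succ_sub {x y y' x' : ZMod n → ℝ} (h : Exch x y y' x') (i : ZMod n) :
    x i * x (i + 1) - y' i * y' (i + 1) = (x (i + 1) - y' (i + 1)) * (x i + y (i + 1)) := by
  linear_combination y' (i + 1) * (h i).2 - (h (i + 1)).1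

theorem Exch.mul_succ_sub' {x y y' x' : ZMod n → ℝ} (h : Exch x y y' x') (i : ZMod n) :
    x' (i + 1) * x' i - y (i + 1) * y i = (x' i - y i) * (x i + y (i + 1)) := by
  linear_combination -x' i * (h i).2 + (h i).1

variable [NeZero n]

/-- The lift of `κ`. -/
def Reflector.gKappa (κ : Reflector n) (x : ZMod n → ℝ) (i : ZMod n) : ℝ := x (κ.perm i)

/-- The lift of `I`. -/
noncomputable def Reflector.gI : Reflector n → (ZMod n → ℝ) → ℝ
  | .rotateLeft, x => (x 1)⁻¹
  | .switch1n _, x => x 0 / x 1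
  | .switch12 _, _ => 1

/-- Both sides of the reflection equation for `Rotateleft` solve the same exchange relations. -/
theorem Exch.reflection_rotate {x y y₁ x₁ : ZMod n → ℝ} (h : Exch x y y₁ x₁)
    (κ : Reflector n) (hκ : ∀ i, κ.perm i = i + 1)
    (hx : ∀ i, 0 < x i) (hy : ∀ i, 0 < y i) :
    Exch (κ.gKappa (gShift x (κ.gKappa y))) (gShift (κ.gKappa y) x)
      (κ.gKappa (gShift y₁ (κ.gKappa x₁))) (gShift (κ.gKappa x₁) y₁) := by
  have hS : ∀ i, x i + y (i + 1) ≠ 0 := fun i => (add_pos (hx i) (hy _)).ne'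
  intro i
  have e0 := (h i).2
  have e1 := (h (i + 1)).2
  have e2 := (h (i + 1 + 1)).2
  have n0 := hS i
  have n1 := hS (i + 1)
  have n2 := hS (i + 1 + 1)
  simp only [Reflector.gKappa, gShift, gP, hκ, sub_add_cancel, add_sub_cancel_right]
  -- By the additive exchange relation, both sides have the same denominators `x j + y (j + 1)`.
  rw [add_comm (y (i + 1)) (x i), add_comm (y (i + 1 + 1)) (x (i + 1)),
    add_comm (y (i + 1 + 1 + 1)) (x (i + 1 + 1)),
    add_comm (x₁ (i + 1)) (y₁ i), add_comm (x₁ (i + 1 + 1)) (y₁ (i + 1)),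
    add_comm (x₁ (i + 1 + 1 + 1)) (y₁ (i + 1 + 1)), ← e0, ← e1, ← e2]
  constructor
  · field_simp
    linear_combination (h (i + 1)).1
  · field_simp
    linear_combination e1

/-! ### Reflection by the pairwise switches -/

section Switch

variable {κ : Reflector n} {F : ZMod n → Prop}

/-- `F` marks the first index of each swapped pair `{i, i + 1}`. Here only that pair enters; at the
second index the next pair enters as well. -/
theorem gShift_kappa_first (h0 : ∀ i, F i → κ.perm i = i + 1)
    (h1 : ∀ i, F i → κ.perm (i + 1) = i) (x y : ZMod n → ℝ) {i : ZMod n} (hi : F i) :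
    gShift x (κ.gKappa y) i = x i * (x (i + 1) + y i) / (x i + y (i + 1)) ∧
    gShift (κ.gKappa y) x i = y (i + 1) * (x (i + 1) + y i) / (x i + y (i + 1)) := by
  simp [gShift, gP, Reflector.gKappa, h0 i hi, h1 i hi, add_comm]

theorem gShift_kappa_second (h0 : ∀ i, F i → κ.perm i = i + 1)
    (h1 : ∀ i, F i → κ.perm (i + 1) = i) (h2 : ∀ i, F i → F (i + 1 + 1))
    (x y : ZMod n → ℝ) {i : ZMod n} (hi : F i) :
    gShift x (κ.gKappa y) (i + 1)
      = x (i + 1) * (x (i + 1 + 1) + y (i + 1 + 1 + 1)) / (x (i + 1) + y i) ∧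
    gShift (κ.gKappa y) x (i + 1)
      = y i * (x (i + 1 + 1) + y (i + 1 + 1 + 1)) / (x (i + 1) + y i) := by
  have := h0 _ (h2 i hi)
  simp only [gShift, gP, Reflector.gKappa, this, h1 i hi, add_sub_cancel_right]
  constructor
  · trivial
  · rw [add_comm (y (i + 1 + 1 + 1)), add_comm (y i)]

/-- Both sides of the reflection equation for the switches solve the same exchange relations. -/
theorem Exch.reflection_switch {x y y₁ x₁ : ZMod n → ℝ} (h : Exch x y y₁ x₁)
    (h0 : ∀ i, F i → κ.perm i = i + 1) (h1 : ∀ i, F i → κ.perm (i + 1) = i)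
    (h2 : ∀ i, F i → F (i + 1 + 1)) (hF : ∀ i, F i ∨ ∃ j, F j ∧ i = j + 1)
    (hx : ∀ i, 0 < x i) (hy : ∀ i, 0 < y i) (hx₁ : ∀ i, 0 < x₁ i) (hy₁ : ∀ i, 0 < y₁ i) :
    Exch (κ.gKappa (gShift x (κ.gKappa y))) (gShift (κ.gKappa y) x)
      (κ.gKappa (gShift y₁ (κ.gKappa x₁))) (gShift (κ.gKappa x₁) y₁) := by
  have hS : ∀ i, x i + y (i + 1) ≠ 0 := fun i => (add_pos (hx i) (hy _)).ne'
  have hU : ∀ i, x (i + 1) + y i ≠ 0 := fun i => (add_pos (hx _) (hy _)).ne'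
  have hV : ∀ i, y₁ (i + 1) + x₁ i ≠ 0 := fun i => (add_pos (hy₁ _) (hx₁ _)).ne'
  have hk0 : ∀ (f : ZMod n → ℝ) i, F i → κ.gKappa f i = f (i + 1) := fun f i hi => by
    rw [Reflector.gKappa, h0 i hi]
  have hk1 : ∀ (f : ZMod n → ℝ) i, F i → κ.gKappa f (i + 1) = f i := fun f i hi => by
    rw [Reflector.gKappa, h1 i hi]
  intro i
  rcases hF i with hi | ⟨i, hi, rfl⟩
  · rw [hk0 _ i hi, hk0 _ i hi, (gShift_kappa_second h0 h1 h2 x y hi).1,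
      (gShift_kappa_second h0 h1 h2 x y hi).2, (gShift_kappa_first h0 h1 x y hi).2,
      (gShift_kappa_second h0 h1 h2 y₁ x₁ hi).1, (gShift_kappa_second h0 h1 h2 y₁ x₁ hi).2,
      (gShift_kappa_first h0 h1 y₁ x₁ hi).2, ← (h i).2, ← (h (i + 1 + 1)).2]
    have n0 := hS i
    have n1 := hU i
    have n2 := hV i
    constructor
    · field_simp
      linear_combination (x (i + 1 + 1) + y (i + 1 + 1 + 1)) * (h (i + 1)).1
    · field_simp
  · have hi' := h2 i hi
    rw [hk1 _ i hi, hk1 _ i hi, (gShift_kappa_first h0 h1 x y hi).1,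
      (gShift_kappa_first h0 h1 x y hi').2, (gShift_kappa_second h0 h1 h2 x y hi).2,
      (gShift_kappa_first h0 h1 y₁ x₁ hi).1,
      (gShift_kappa_first h0 h1 y₁ x₁ hi').2, (gShift_kappa_second h0 h1 h2 y₁ x₁ hi).2,
      ← (h i).2, ← (h (i + 1 + 1)).2]
    have n0 := hS i
    have n1 := hU i
    have n2 := hV i
    have n3 := hS (i + 1 + 1)
    constructor
    · field_simp
      linear_combination (h i).1
    · have a := h.mul_succ_sub i
      have b := h.mul_succ_sub' (i + 1 + 1)
      have c := (h (i + 1)).2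
      have d := (h i).1
      have d' := (h (i + 1 + 1 + 1)).1
      -- `a'` and `b'` show that the reflected entries differ exactly as the original ones do, so
      -- the additive relation at `i + 1` carries over.
      have a' : x i * (x (i + 1) + y i) / (x i + y (i + 1))
          = y₁ i * (y₁ (i + 1) + x₁ i) / (x i + y (i + 1)) + (x (i + 1) - y₁ (i + 1)) := by
        field_simp
        linear_combination a + d
      have b' : x₁ (i + 1 + 1 + 1) * (y₁ (i + 1 + 1 + 1) + x₁ (i + 1 + 1))
            / (x (i + 1 + 1) + y (i + 1 + 1 + 1))
          = y (i + 1 + 1 + 1) * (x (i + 1 + 1 + 1) + y (i + 1 + 1))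
            / (x (i + 1 + 1) + y (i + 1 + 1 + 1)) + (x₁ (i + 1 + 1) - y (i + 1 + 1)) := by
        field_simp
        linear_combination b - d'
      rw [a', b']
      linear_combination c

/-- For the switches, `Q` at the second element of a pair does not change. -/
theorem Exch.reflection_switch_diff {x y y₁ x₁ : ZMod n → ℝ} (h : Exch x y y₁ x₁)
    (h0 : ∀ i, F i → κ.perm i = i + 1) (h1 : ∀ i, F i → κ.perm (i + 1) = i)
    (hx : ∀ i, 0 < x i) (hy : ∀ i, 0 < y i) {i : ZMod n} (hi : F i) :
    κ.gKappa (gShift x (κ.gKappa y)) (i + 1) - κ.gKappa (gShift y₁ (κ.gKappa x₁)) (i + 1)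
      = x (i + 1) - y₁ (i + 1) := by
  have n0 : x i + y (i + 1) ≠ 0 := (add_pos (hx i) (hy _)).ne'
  rw [Reflector.gKappa, Reflector.gKappa, h1 i hi, (gShift_kappa_first h0 h1 x y hi).1,
    (gShift_kappa_first h0 h1 y₁ x₁ hi).1, ← (h i).2]
  field_simp
  linear_combination h.mul_succ_sub i + (h i).1

end Switch

/-! ### Arrays and energies in the lifted reflection equation -/

variable {x y : ZMod n → ℝ}

theorem Reflector.gKappa_pos (κ : Reflector n) (hx : ∀ i, 0 < x i) (i : ZMod n) :
    0 < κ.gKappa x i := hx _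

theorem Reflector.prod_gKappa (κ : Reflector n) (x : ZMod n → ℝ) :
    ∏ i, κ.gKappa x i = ∏ i, x i := Equiv.prod_comp κ.perm x

theorem exch_reflection (κ : Reflector n) (hx : ∀ i, 0 < x i) (hy : ∀ i, 0 < y i) :
    Exch (κ.gKappa (gShift x (κ.gKappa y))) (gShift (κ.gKappa y) x)
      (κ.gKappa (gShift (gDown x y) (κ.gKappa (gUp x y))))
      (gShift (κ.gKappa (gUp x y)) (gDown x y)) := by
  have h := exch_gQ hx hy
  cases κ with
  | rotateLeft => exact h.reflection_rotate _ (fun i => rfl) hx hy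
  | switch1n hn =>
    refine h.reflection_switch (F := fun i => Even i.val) ?_ ?_ ?_ ?_ hx hy (gUp_pos hx hy)
      (gDown_pos hx hy)
    · intro i hi
      simp [Reflector.perm, swapEven, hi]
    · intro i hi
      simp [Reflector.perm, swapEven, even_val_add_one hn, hi]
    · intro i hi
      simpa [even_val_add_one hn] using hi
    · intro i
      by_cases hi : Even i.val
      · exact Or.inl hi
      · exact Or.inr ⟨i - 1, (even_val_sub_one hn i).2 hi, by ring⟩
  | switch12 hn =>
    refine h.reflection_switch (F := fun i => ¬ Even i.val) ?_ ?_ ?_ ?_ hx hy (gUp_pos hx hy)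
      (gDown_pos hx hy)
    · intro i hi
      simp [Reflector.perm, swapOdd, hi]
    · intro i hi
      simp [Reflector.perm, swapOdd, even_val_add_one hn, hi]
    · intro i hi
      simpa [even_val_add_one hn] using hi
    · intro i
      by_cases hi : Even i.val
      · exact Or.inr ⟨i - 1, fun h => (even_val_sub_one hn i).1 h hi, by ring⟩
      · exact Or.inl hi

theorem gReflection_elements (κ : Reflector n) (hx : ∀ i, 0 < x i) (hy : ∀ i, 0 < y i)
    (hXY : ∏ a, x a ≠ ∏ a, y a) :
    gDown (κ.gKappa (gShift x (κ.gKappa y))) (gShift (κ.gKappa y) x)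
      = κ.gKappa (gShift (gDown x y) (κ.gKappa (gUp x y))) ∧
    gUp (κ.gKappa (gShift x (κ.gKappa y))) (gShift (κ.gKappa y) x)
      = gShift (κ.gKappa (gUp x y)) (gDown x y) := by
  have hy' := κ.gKappa_pos hy
  have hp := κ.gKappa_pos (gShift_pos hx hy')
  have hq := gShift_pos hy' hx
  have hx₁ := gUp_pos hx hy
  have hy₁ := gDown_pos hx hy
  refine (exch_gQ hp hq).unique (exch_reflection κ hx hy)
    (fun i => (gDown_pos hp hq i).ne') (fun i => (gUp_pos hp hq i).ne') ?_ ?_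
  · rw [prod_gUp hp hq, κ.prod_gKappa, prod_gShift hx hy',
      prod_gShift (κ.gKappa_pos hx₁) hy₁, κ.prod_gKappa, prod_gUp hx hy]
  · rw [prod_gUp hp hq, κ.prod_gKappa, κ.prod_gKappa, prod_gShift hx hy',
      prod_gShift hy₁ (κ.gKappa_pos hx₁), prod_gDown hx hy]
    exact hXY.symm

/-- Determines the `gQ` of the reflected pair from explicitly known entries. -/
theorem gReflection_sub (κ : Reflector n) (hx : ∀ i, 0 < x i) (hy : ∀ i, 0 < y i)
    (hXY : ∏ a, x a ≠ ∏ a, y a) (i : ZMod n) :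
    κ.gKappa (gShift x (κ.gKappa y)) i - κ.gKappa (gShift (gDown x y) (κ.gKappa (gUp x y))) i
      = (∏ a, x a - ∏ a, y a)
        / gQ (κ.gKappa (gShift x (κ.gKappa y))) (gShift (κ.gKappa y) x) i := by
  have hy' := κ.gKappa_pos hy
  rw [← (gReflection_elements κ hx hy hXY).1,
    sub_gDown (κ.gKappa_pos (gShift_pos hx hy')) (gShift_pos hy' hx),
    κ.prod_gKappa, prod_gShift hx hy', prod_gShift hy' hx, κ.prod_gKappa]

/-- The energies in the lift of the reflection equation. -/
theorem gReflection_energies (κ : Reflector n) (hx : ∀ i, 0 < x i) (hy : ∀ i, 0 < y i)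
    (hXY : ∏ a, x a ≠ ∏ a, y a) :
    gP x (κ.gKappa y) 0 * gQ (κ.gKappa (gShift x (κ.gKappa y))) (gShift (κ.gKappa y) x) 0
        * κ.gI (gUp x y)
      = gQ x y 0 * gP (gDown x y) (κ.gKappa (gUp x y)) 0 * κ.gI (gShift x (κ.gKappa y)) ∧
    gQ (κ.gKappa (gShift x (κ.gKappa y))) (gShift (κ.gKappa y) x) 0
        * gP (gDown x y) (κ.gKappa (gUp x y)) 0 * κ.gI y
      = gQ x y 0 * gP x (κ.gKappa y) 0 * κ.gI (gShift (gDown x y) (κ.gKappa (gUp x y))) := by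
  have hE := exch_gQ hx hy
  have hD := sub_ne_zero.2 hXY
  have hy' := κ.gKappa_pos hy
  have hx₁ := gUp_pos hx hy
  have hy₁ := gDown_pos hx hy
  have q0 := gQ_pos hx hy 0
  have q1 := gQ_pos hx hy 1
  have q' := gQ_pos (κ.gKappa_pos (gShift_pos hx hy')) (gShift_pos hy' hx) 0
  have hsub := gReflection_sub κ hx hy hXY
  have helt := (gReflection_elements κ hx hy hXY).2
  have ex₁ : gUp x y 1 = x 1 * gQ x y 1 / gQ x y 0 := by rw [gUp, sub_self]
  have ey₁ : gDown x y 1 = y 1 * gQ x y 0 / gQ x y 1 := by rw [gDown, sub_self]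
  cases κ with
  | rotateLeft =>
    have hk : ∀ (f : ZMod n → ℝ) i, Reflector.rotateLeft.gKappa f i = f (i + 1) := fun _ _ => rfl
    have s1 : 0 < x 1 + y (1 + 1) := add_pos (hx _) (hy _)
    have s2 : 0 < x (1 + 1) + y (1 + 1 + 1) := add_pos (hx _) (hy _)
    have p1 : gDown x y 1 + gUp x y (1 + 1) = x 1 + y (1 + 1) := (hE 1).2.symm
    have p2 : gDown x y (1 + 1) + gUp x y (1 + 1 + 1) = x (1 + 1) + y (1 + 1 + 1) :=
      (hE (1 + 1)).2.symm
    have a1 : gShift x (Reflector.rotateLeft.gKappa y) 1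
        = x 1 * (x (1 + 1) + y (1 + 1 + 1)) / (x 1 + y (1 + 1)) := by
      simp only [gShift, gP, hk, sub_add_cancel]
    have a2 : gShift (gDown x y) (Reflector.rotateLeft.gKappa (gUp x y)) 1
        = gDown x y 1 * (x (1 + 1) + y (1 + 1 + 1)) / (x 1 + y (1 + 1)) := by
      simp only [gShift, gP, hk, sub_add_cancel, p1, p2]
    -- Entry `0` after rotation is entry `1` before it, so the new `gQ` at `0` is expressed through
    -- `gQ x y 1`.
    have e := hsub 0
    rw [hk, hk, zero_add, a1, a2, mul_div_assoc, mul_div_assoc, ← sub_mul, sub_gDown hx hy,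
      div_mul_div_comm, div_eq_div_iff (mul_pos q1 s1).ne' q'.ne', mul_assoc] at e
    have e' := mul_left_cancel₀ hD e
    simp only [Reflector.gI]
    rw [a1, a2]
    simp only [gP, hk, zero_add]
    rw [p1, ex₁, ey₁]
    have x1 := hx 1
    have y1 := hy 1
    generalize gQ (Reflector.rotateLeft.gKappa (gShift x (Reflector.rotateLeft.gKappa y)))
      (gShift (Reflector.rotateLeft.gKappa y) x) 0 = r at *
    constructor
    · field_simp
      linear_combination e'
    · field_simp
      linear_combination e'
  | switch1n hn =>
    have h0 : ∀ i : ZMod n, Even i.val → (Reflector.switch1n hn).perm i = i + 1 := fun i hi => by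
      simp [Reflector.perm, swapEven, hi]
    have h1 : ∀ i : ZMod n, Even i.val → (Reflector.switch1n hn).perm (i + 1) = i :=
      fun i hi => by simp [Reflector.perm, swapEven, even_val_add_one hn, hi]
    have h2 : ∀ i : ZMod n, Even i.val → Even (i + 1 + 1).val := fun i hi => by
      simpa [even_val_add_one hn] using hi
    have hz : Even (0 : ZMod n).val := by simp
    have hk : ∀ (f : ZMod n → ℝ), (Reflector.switch1n hn).gKappa f 1 = f 0 := fun f => by
      rw [Reflector.gKappa, ← zero_add (1 : ZMod n), h1 0 hz]
    have b0 := gShift_kappa_first h0 h1 x y hz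
    have b1 := gShift_kappa_second h0 h1 h2 x y hz
    have c0 := gShift_kappa_first h0 h1 (gDown x y) (gUp x y) hz
    have c1 := gShift_kappa_second h0 h1 h2 (gDown x y) (gUp x y) hz
    have e := hE.reflection_switch_diff h0 h1 hx hy hz
    have q1' := gQ_pos ((Reflector.switch1n hn).gKappa_pos (gShift_pos hx hy'))
      (gShift_pos hy' hx) 1
    -- The pair is `{0, 1}`, so the unchanged `gQ` is the one at `1`. Entry `1` of the `gUp`
    -- identity supplies the ratio of the new `gQ` at `1` to that at `0`.
    have d := congrFun helt 1
    rw [gUp, sub_self, hk] at d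
    simp only [zero_add] at b0 b1 c0 c1 e
    rw [hsub 1, sub_gDown hx hy, div_eq_div_iff q1'.ne' q1.ne'] at e
    rw [← mul_left_cancel₀ hD e, b0.1, c1.2, ← (hE (1 + 1)).2] at d
    have p0 := (hE 0).2
    rw [zero_add] at p0
    rw [← p0] at c0
    rw [← (hE (1 + 1)).2] at c1
    have g0 : gP x ((Reflector.switch1n hn).gKappa y) 0 = x 1 + y 0 := by
      rw [gP, zero_add, hk]
    have g1 : gP (gDown x y) ((Reflector.switch1n hn).gKappa (gUp x y)) 0
        = gDown x y 1 + gUp x y 0 := by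
      rw [gP, zero_add, hk]
    simp only [Reflector.gI]
    rw [g0, g1, b0.1, b1.1, c0.1, c1.1]
    have px₀ := hx₁ 0
    have py₀ := hy₁ 0
    have w := (hE 0).1
    have x0 := hx 0
    have y0 := hy 0
    have x1 := hx 1
    have y1 := hy 1
    have s0 : 0 < x 0 + y 1 := add_pos x0 y1
    have s2 : 0 < x (1 + 1) + y (1 + 1 + 1) := add_pos (hx _) (hy _)
    have u0 : 0 < x 1 + y 0 := add_pos x1 y0
    have v0 : 0 < gDown x y 1 + gUp x y 0 := add_pos (hy₁ 1) px₀
    have hd : gQ ((Reflector.switch1n hn).gKappa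
        (gShift x ((Reflector.switch1n hn).gKappa y)))
        (gShift ((Reflector.switch1n hn).gKappa y) x) 0
        = x 0 * (x 1 + y 0) * gQ x y 1 * (gDown x y 1 + gUp x y 0)
          / ((x 0 + y 1) * gUp x y 0 * (x (1 + 1) + y (1 + 1 + 1))) := by
      rw [div_eq_div_iff q'.ne' v0.ne'] at d
      rw [eq_div_iff (mul_pos (mul_pos s0 px₀) s2).ne']
      field_simp at d
      linear_combination -d
    rw [hd]
    generalize gDown x y 1 + gUp x y 0 = v at *
    rw [ex₁, ey₁]
    constructor
    · field_simp
    · field_simp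
      linear_combination w
  | switch12 hn =>
    have h0 : ∀ i : ZMod n, ¬ Even i.val → (Reflector.switch12 hn).perm i = i + 1 :=
      fun i hi => by simp [Reflector.perm, swapOdd, hi]
    have h1 : ∀ i : ZMod n, ¬ Even i.val → (Reflector.switch12 hn).perm (i + 1) = i :=
      fun i hi => by simp [Reflector.perm, swapOdd, even_val_add_one hn, hi]
    have hz : Even (0 : ZMod n).val := by simp
    have ho : ¬ Even (1 : ZMod n).val := fun h => (even_val_add_one hn 0).1 (by simpa using h) hz
    have hm : ¬ Even (0 - 1 : ZMod n).val := fun h => (even_val_sub_one hn 0).1 h hz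
    have hk : ∀ (f : ZMod n → ℝ), (Reflector.switch12 hn).gKappa f 1 = f (1 + 1) := fun f => by
      rw [Reflector.gKappa, h0 1 ho]
    -- Here `0` is the second element of the pair `{-1, 0}`, so `gQ` at `0` is unchanged.
    have e := hE.reflection_switch_diff h0 h1 hx hy hm
    rw [sub_add_cancel, hsub 0, sub_gDown hx hy, div_eq_div_iff q'.ne' q0.ne'] at e
    have g : gP x ((Reflector.switch12 hn).gKappa y) 0
        = gP (gDown x y) ((Reflector.switch12 hn).gKappa (gUp x y)) 0 := by
      rw [gP, gP, zero_add, hk, hk]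
      exact (hE 1).2
    rw [← mul_left_cancel₀ hD e, g]
    simp only [Reflector.gI, and_self, mul_comm]

end LiftedReflection

section Tropical

/-! ## Tropicalization -/

/-- The positive function `f` decays like `exp (-a t)`. -/
structure Trop (f : ℝ → ℝ) (a : ℤ) : Prop where
  pos : ∀ t, 0 < f t
  lim : Filter.Tendsto (fun t => -Real.log (f t) / t) Filter.atTop (nhds (a : ℝ))

theorem Trop.unique {f g : ℝ → ℝ} {a b : ℤ} (hf : Trop f a) (hg : Trop g b)
    (h : ∀ᶠ t in Filter.atTop, f t = g t) : a = b := by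
  have h1 := hf.lim.congr' (h.mono fun t ht => show _ = -Real.log (g t) / t by rw [ht])
  exact_mod_cast tendsto_nhds_unique h1 hg.lim

theorem Trop.mul {f g : ℝ → ℝ} {a b : ℤ} (hf : Trop f a) (hg : Trop g b) :
    Trop (fun t => f t * g t) (a + b) := by
  refine ⟨fun t => mul_pos (hf.pos t) (hg.pos t), ?_⟩
  push_cast
  refine (hf.lim.add hg.lim).congr fun t => ?_
  rw [Real.log_mul (hf.pos t).ne' (hg.pos t).ne']
  ring

theorem Trop.inv {f : ℝ → ℝ} {a : ℤ} (hf : Trop f a) : Trop (fun t => (f t)⁻¹) (-a) := by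
  refine ⟨fun t => inv_pos.2 (hf.pos t), ?_⟩
  push_cast
  refine hf.lim.neg.congr fun t => ?_
  rw [Real.log_inv]
  ring

theorem Trop.div {f g : ℝ → ℝ} {a b : ℤ} (hf : Trop f a) (hg : Trop g b) :
    Trop (fun t => f t / g t) (a - b) := by
  simpa only [div_eq_mul_inv, sub_eq_add_neg] using hf.mul hg.inv

theorem Trop.const {c : ℝ} (hc : 0 < c) : Trop (fun _ => c) 0 := by
  refine ⟨fun _ => hc, ?_⟩
  push_cast
  exact tendsto_const_nhds.div_atTop Filter.tendsto_id

theorem Trop.exp (a : ℤ) : Trop (fun t => Real.exp (-(a * t))) a := by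
  refine ⟨fun t => Real.exp_pos _, ?_⟩
  refine tendsto_const_nhds.congr' ?_
  filter_upwards [Filter.eventually_gt_atTop 0] with t ht
  rw [Real.log_exp, neg_neg, mul_div_cancel_right₀ _ ht.ne']

/-- The sum lies between the maximum and twice the maximum, and `log 2 / t` tends to `0`. -/
theorem Trop.add {f g : ℝ → ℝ} {a b : ℤ} (hf : Trop f a) (hg : Trop g b) :
    Trop (fun t => f t + g t) (min a b) := by
  refine ⟨fun t => add_pos (hf.pos t) (hg.pos t), ?_⟩
  push_cast
  have hu := hf.lim.min hg.lim
  have h2 : Filter.Tendsto (fun t : ℝ => Real.log 2 / t) Filter.atTop (nhds 0) :=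
    tendsto_const_nhds.div_atTop Filter.tendsto_id
  have hl := hu.sub h2
  rw [sub_zero] at hl
  refine tendsto_of_tendsto_of_tendsto_of_le_of_le' hl hu ?_ ?_
  · filter_upwards [Filter.eventually_gt_atTop 0] with t ht
    have h1 := hf.pos t
    have h3 := hg.pos t
    rw [min_div_div_right ht.le, ← sub_div]
    refine div_le_div_of_nonneg_right ?_ ht.le
    rcases le_total (f t) (g t) with h | h
    · have h4 : Real.log (f t + g t) ≤ Real.log (2 * g t) :=
        Real.log_le_log (by linarith) (by linarith)
      rw [Real.log_mul two_ne_zero h3.ne'] at h4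
      have := min_le_right (-Real.log (f t)) (-Real.log (g t))
      linarith
    · have h4 : Real.log (f t + g t) ≤ Real.log (2 * f t) :=
        Real.log_le_log (by linarith) (by linarith)
      rw [Real.log_mul two_ne_zero h1.ne'] at h4
      have := min_le_left (-Real.log (f t)) (-Real.log (g t))
      linarith
  · filter_upwards [Filter.eventually_gt_atTop 0] with t ht
    have h1 := hf.pos t
    have h3 := hg.pos t
    rw [min_div_div_right ht.le]
    refine div_le_div_of_nonneg_right (le_min ?_ ?_) ht.le
    · exact neg_le_neg (Real.log_le_log h1 (by linarith))
    · exact neg_le_neg (Real.log_le_log h3 (by linarith))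

theorem Trop.prod {ι : Type*} (s : Finset ι) {f : ι → ℝ → ℝ} {a : ι → ℤ}
    (h : ∀ i, Trop (f i) (a i)) : Trop (fun t => ∏ i ∈ s, f i t) (∑ i ∈ s, a i) := by
  classical
  induction s using Finset.induction_on with
  | empty => simpa using Trop.const one_pos
  | insert i s hi ih => simpa only [Finset.prod_insert hi, Finset.sum_insert hi] using (h i).mul ih

theorem Trop.sum {ι : Type*} {s : Finset ι} (hs : s.Nonempty) {f : ι → ℝ → ℝ} {a : ι → ℤ}
    (h : ∀ i, Trop (f i) (a i)) : Trop (fun t => ∑ i ∈ s, f i t) (s.inf' hs a) := by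
  classical
  induction hs using Finset.Nonempty.cons_induction with
  | singleton i => simpa using h i
  | cons i s hi hs ih => simpa only [Finset.sum_cons, Finset.inf'_cons hs] using (h i).add ih

variable {n : ℕ}

/-- Coordinatewise `Trop`. -/
def TropArr (X : ℝ → ZMod n → ℝ) (x : ZMod n → ℤ) : Prop := ∀ i, Trop (fun t => X t i) (x i)

theorem TropArr.pos {X : ℝ → ZMod n → ℝ} {x : ZMod n → ℤ} (h : TropArr X x) (t : ℝ) (i : ZMod n) :
    0 < X t i := (h i).pos t

theorem TropArr.unique {X Y : ℝ → ZMod n → ℝ} {x y : ZMod n → ℤ} (hX : TropArr X x)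
    (hY : TropArr Y y) (h : ∀ᶠ t in Filter.atTop, X t = Y t) : x = y :=
  funext fun i => (hX i).unique (hY i) (h.mono fun _ ht => congrFun ht i)

theorem TropArr.gP {X Y : ℝ → ZMod n → ℝ} {x y : ZMod n → ℤ} (hX : TropArr X x) (hY : TropArr Y y) (i : ZMod n) :
    Trop (fun t => gP (X t) (Y t) i) (P x y i) := (hX _).add (hY _)

/-- The lift `c exp (-x_i t)` of an array. -/
noncomputable def lift (c : ℝ) (x : ZMod n → ℤ) (t : ℝ) (i : ZMod n) : ℝ :=
  c * Real.exp (-(x i * t))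

theorem tropArr_lift {c : ℝ} (hc : 0 < c) (x : ZMod n → ℤ) : TropArr (lift c x) x := fun i => by
  simpa only [zero_add, lift] using (Trop.const hc).mul (Trop.exp (x i))

variable [NeZero n]

theorem prod_lift (c : ℝ) {l : ℕ} (x : Arr n l) (t : ℝ) :
    ∏ i, lift c x.1 t i = c ^ n * Real.exp (-(l * t)) := by
  simp only [lift]
  rw [Finset.prod_mul_distrib, Finset.prod_const, Finset.card_univ, ZMod.card, ← Real.exp_sum,
    Finset.sum_neg_distrib, ← Finset.sum_mul]
  have := x.2.2
  rw [← Int.cast_sum, this, Int.cast_natCast]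

/-- Uniqueness of factorizations needs distinct products. The constants `c ≠ d` ensure this even if
`l = m`, and they do not affect the limit. -/
theorem eventually_prod_lift_ne {c d : ℝ} (hc : 0 < c) (hd : 0 < d) (hcd : c ≠ d) {l m : ℕ}
    (x : Arr n l) (y : Arr n m) :
    ∀ᶠ t in Filter.atTop, ∏ i, lift c x.1 t i ≠ ∏ i, lift d y.1 t i := by
  have hn : (n : ℝ) ≠ 0 := NeZero.ne _
  have hlog : Real.log c ≠ Real.log d := fun h => hcd (Real.log_injOn_pos hc hd h)
  have key : ∀ t, ∏ i, lift c x.1 t i = ∏ i, lift d y.1 t i →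
      ((l : ℝ) - m) * t = n * (Real.log c - Real.log d) := by
    intro t h
    rw [prod_lift, prod_lift] at h
    have h1 := congrArg Real.log h
    rw [Real.log_mul (pow_pos hc n).ne' (Real.exp_pos _).ne',
      Real.log_mul (pow_pos hd n).ne' (Real.exp_pos _).ne', Real.log_exp, Real.log_exp,
      Real.log_pow, Real.log_pow] at h1
    linarith
  -- For `l ≠ m` this is the only possible coincidence. For `l = m` the quotient is the default `0`,
  -- and the products never coincide.
  filter_upwards [Filter.eventually_ne_atTop
    ((n * (Real.log c - Real.log d)) / ((l : ℝ) - m))] with t ht h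
  have h1 := key t h
  by_cases hlm : (l : ℝ) - m = 0
  · rw [hlm, zero_mul] at h1
    exact mul_ne_zero hn (sub_ne_zero.2 hlog) h1.symm
  · exact ht (by rw [← h1]; field_simp)

variable {X Y : ℝ → ZMod n → ℝ}

theorem TropArr.gQ {x y : ZMod n → ℤ} (hX : TropArr X x) (hY : TropArr Y y) (i : ZMod n) :
    Trop (fun t => gQ (X t) (Y t) i) (Q x y i) :=
  Trop.sum _ fun k : ℕ => (Trop.prod (Finset.Ico 1 k) fun j : ℕ => hX (i + (j : ZMod n))).mul
    (Trop.prod (Finset.Ioc k n) fun j : ℕ => hY (i + (j : ZMod n)))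

theorem TropArr.gUp {l m : ℕ} {x : Arr n l} {y : Arr n m} (hX : TropArr X x.1)
    (hY : TropArr Y y.1) : TropArr (fun t => gUp (X t) (Y t)) (upQ x y).1 :=
  fun i => ((hX i).mul (hX.gQ hY i)).div (hX.gQ hY (i - 1))

theorem TropArr.gDown {l m : ℕ} {x : Arr n l} {y : Arr n m} (hX : TropArr X x.1)
    (hY : TropArr Y y.1) : TropArr (fun t => gDown (X t) (Y t)) (downQ x y).1 :=
  fun i => ((hY i).mul (hX.gQ hY (i - 1))).div (hX.gQ hY i)

theorem TropArr.gShift {l m : ℕ} {x : Arr n l} {y : Arr n m} (hX : TropArr X x.1)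
    (hY : TropArr Y y.1) : TropArr (fun t => gShift (X t) (Y t)) (shiftP x y).1 :=
  fun i => ((hX i).mul (hX.gP hY i)).div (hX.gP hY (i - 1))

theorem TropArr.gKappa (κ : Reflector n) {l : ℕ} {x : B n l} (hX : TropArr X x.1) :
    TropArr (fun t => κ.gKappa (X t)) (κ.kappa x).1 := fun i => hX (κ.perm i)

theorem TropArr.gI (κ : Reflector n) {l : ℕ} {x : B n l} (hX : TropArr X x.1) :
    Trop (fun t => κ.gI (X t)) (κ.I x) := by
  cases κ with
  | rotateLeft => exact (hX 1).inv
  | switch1n h => exact (hX 0).div (hX 1)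
  | switch12 h => exact Trop.const one_pos

end Tropical

section CombinatorialEquations

/-! ## The Yang–Baxter and reflection equations -/

variable {n : ℕ} [NeZero n] {l m k : ℕ}

/-- The Yang–Baxter equation for three solid arrays. -/
theorem yangBaxter (x : Arr n l) (y : Arr n m) (z : Arr n k) :
    downQ (downQ x y) (downQ (upQ x y) z) = downQ x (downQ y z) ∧
    upQ (downQ x y) (downQ (upQ x y) z) = downQ (upQ x (downQ y z)) (upQ y z) ∧
    upQ (upQ x y) z = upQ (upQ x (downQ y z)) (upQ y z) ∧
    (∀ i, Q x.1 y.1 i + Q (upQ x y).1 z.1 i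
      = Q x.1 (downQ y z).1 i + Q (upQ x (downQ y z)).1 (upQ y z).1 i) ∧
    ∀ i, Q (upQ x y).1 z.1 i + Q (downQ x y).1 (downQ (upQ x y) z).1 i
      = Q y.1 z.1 i + Q x.1 (downQ y z).1 i := by
  have hX := tropArr_lift (c := 1) one_pos x.1
  have hY := tropArr_lift (c := 2) two_pos y.1
  have hZ := tropArr_lift (c := 3) three_pos z.1
  have h := ((eventually_prod_lift_ne one_pos two_pos (by norm_num) x y).and
    ((eventually_prod_lift_ne one_pos three_pos (by norm_num) x z).and
      (eventually_prod_lift_ne two_pos three_pos (by norm_num) y z))).mono fun t h =>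
    gYangBaxter (hX.pos t) (hY.pos t) (hZ.pos t) h.1 h.2.1 h.2.2
  refine ⟨Subtype.ext ?_, Subtype.ext ?_, Subtype.ext ?_, fun i => ?_, fun i => ?_⟩
  · exact ((hX.gDown hY).gDown ((hX.gUp hY).gDown hZ)).unique (hX.gDown (hY.gDown hZ))
      (h.mono fun t ht => ht.1)
  · exact ((hX.gDown hY).gUp ((hX.gUp hY).gDown hZ)).unique
      ((hX.gUp (hY.gDown hZ)).gDown (hY.gUp hZ)) (h.mono fun t ht => ht.2.1)
  · exact ((hX.gUp hY).gUp hZ).unique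
      ((hX.gUp (hY.gDown hZ)).gUp (hY.gUp hZ)) (h.mono fun t ht => ht.2.2.1)
  · exact ((hX.gQ hY i).mul ((hX.gUp hY).gQ hZ i)).unique
      ((hX.gQ (hY.gDown hZ) i).mul ((hX.gUp (hY.gDown hZ)).gQ (hY.gUp hZ) i))
      (h.mono fun t ht => ht.2.2.2.1 i)
  · exact (((hX.gUp hY).gQ hZ i).mul ((hX.gDown hY).gQ ((hX.gUp hY).gDown hZ) i)).unique
      ((hY.gQ hZ i).mul (hX.gQ (hY.gDown hZ) i)) (h.mono fun t ht => ht.2.2.2.2 i)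

/-- The Yang–Baxter equation for two solid arrays and a dotted one. -/
theorem mixedYangBaxter (x : Arr n l) (y : Arr n m) (z : Arr n k) :
    shiftP (shiftP z (upQ x y)) (downQ x y) = shiftP (shiftP z y) x ∧
    shiftP (downQ x y) (shiftP z (upQ x y)) = downQ (shiftP x (shiftP z y)) (shiftP y z) ∧
    shiftP (upQ x y) z = upQ (shiftP x (shiftP z y)) (shiftP y z) ∧
    (∀ i, Q x.1 y.1 i + P (upQ x y).1 z.1 i
      = P x.1 (shiftP z y).1 i + Q (shiftP x (shiftP z y)).1 (shiftP y z).1 i) ∧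
    ∀ i, P (upQ x y).1 z.1 i + P (downQ x y).1 (shiftP z (upQ x y)).1 i
      = P y.1 z.1 i + P x.1 (shiftP z y).1 i := by
  have hX := tropArr_lift (c := 1) one_pos x.1
  have hY := tropArr_lift (c := 2) two_pos y.1
  -- No condition on the product of the dotted array is needed, so its constant may repeat.
  have hZ := tropArr_lift (c := 1) one_pos z.1
  have h := (eventually_prod_lift_ne one_pos two_pos (by norm_num) x y).mono fun t h =>
    gMixedYangBaxter (hX.pos t) (hY.pos t) (hZ.pos t) h
  have hx := hX.gUp hY
  have hy := hX.gDown hY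
  have hz := hZ.gShift hx
  have hy' := hY.gShift hZ
  have hz' := hZ.gShift hY
  have hx' := hX.gShift hz'
  refine ⟨Subtype.ext ?_, Subtype.ext ?_, Subtype.ext ?_, fun i => ?_, fun i => ?_⟩
  · exact (hz.gShift hy).unique (hz'.gShift hX) (h.mono fun t ht => ht.1)
  · exact (hy.gShift hz).unique (hx'.gDown hy') (h.mono fun t ht => ht.2.1)
  · exact (hx.gShift hZ).unique (hx'.gUp hy') (h.mono fun t ht => ht.2.2.1)
  · exact ((hX.gQ hY i).mul (hx.gP hZ i)).unique ((hX.gP hz' i).mul (hx'.gQ hy' i))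
      (h.mono fun t ht => ht.2.2.2.1 i)
  · exact ((hx.gP hZ i).mul (hy.gP hz i)).unique ((hY.gP hZ i).mul (hX.gP hz' i))
      (h.mono fun t ht => ht.2.2.2.2 i)

/-- The reflection equation. -/
theorem reflection (κ : Reflector n) (x : B n l) (y : B n m) :
    downQ (κ.kappa (shiftP x (κ.kappa y))) (shiftP (κ.kappa y) x)
      = κ.kappa (shiftP (downQ x y) (κ.kappa (upQ x y))) ∧
    upQ (κ.kappa (shiftP x (κ.kappa y))) (shiftP (κ.kappa y) x)
      = shiftP (κ.kappa (upQ x y)) (downQ x y) ∧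
    P x.1 (κ.kappa y).1 0
        + Q (κ.kappa (shiftP x (κ.kappa y))).1 (shiftP (κ.kappa y) x).1 0 + κ.I (upQ x y)
      = Q x.1 y.1 0 + P (downQ x y).1 (κ.kappa (upQ x y)).1 0 + κ.I (shiftP x (κ.kappa y)) ∧
    Q (κ.kappa (shiftP x (κ.kappa y))).1 (shiftP (κ.kappa y) x).1 0
        + P (downQ x y).1 (κ.kappa (upQ x y)).1 0 + κ.I y
      = Q x.1 y.1 0 + P x.1 (κ.kappa y).1 0 + κ.I (shiftP (downQ x y) (κ.kappa (upQ x y))) := by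
  have hX := tropArr_lift (c := 1) one_pos x.1
  have hY := tropArr_lift (c := 2) two_pos y.1
  have h := (eventually_prod_lift_ne one_pos two_pos (by norm_num) x y).mono fun t h =>
    And.intro (gReflection_elements κ (hX.pos t) (hY.pos t) h)
      (gReflection_energies κ (hX.pos t) (hY.pos t) h)
  have hKY := hY.gKappa κ
  have hx := hX.gUp hY
  have hy := hX.gDown hY
  have hKx := hx.gKappa κ
  have hx' := hX.gShift hKY
  have hKx' := hx'.gKappa κ
  have hy' := hKY.gShift hX
  have hy₂ := hy.gShift hKx
  refine ⟨Subtype.ext ?_, Subtype.ext ?_, ?_, ?_⟩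
  · exact (hKx'.gDown hy').unique (hy₂.gKappa κ) (h.mono fun t ht => ht.1.1)
  · exact (hKx'.gUp hy').unique (hKx.gShift hy) (h.mono fun t ht => ht.1.2)
  · exact (((hX.gP hKY 0).mul (hKx'.gQ hy' 0)).mul (hx.gI κ)).unique
      (((hX.gQ hY 0).mul (hy.gP hKx 0)).mul (hx'.gI κ)) (h.mono fun t ht => ht.2.1)
  · exact (((hKx'.gQ hy' 0).mul (hy.gP hKx 0)).mul (hY.gI κ)).unique
      (((hX.gQ hY 0).mul (hX.gP hKY 0)).mul (hy₂.gI κ)) (h.mono fun t ht => ht.2.2)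

end CombinatorialEquations

section Exchange

/-! ## Two carriers at a site and at the reflecting end -/

variable {n : ℕ}

theorem P_comm (x y : ZMod n → ℤ) (i : ZMod n) : P x y i = P y x i := min_comm _ _

variable [NeZero n] {l m : ℕ}

theorem rowDown_eq (a : Aff (B n l)) (b : Local n) :
    rowDown a b = ((downQ a.2 b.1, shiftP b.2 (upQ a.2 b.1)),
      (a.1 + Q a.2.1 b.1.1 0 + P (upQ a.2 b.1).1 b.2.1 0, shiftP (upQ a.2 b.1) b.2)) := rfl

theorem rowUp_eq (b : Local n) (a : Aff (Bv n l)) :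
    rowUp b a = ((a.1 - Q a.2.1 b.2.1 0 - P b.1.1 (upQ a.2 b.2).1 0, shiftP (upQ a.2 b.2) b.1),
      (shiftP b.1 (upQ a.2 b.2), downQ a.2 b.2)) := rfl

/-- Two solid carriers pass through a site. -/
theorem rowDown_exchange (a : Aff (B n l)) (c : Aff (B n m)) (b : Local n) :
    (rowDown a (rowDown c b).1).1 = (rowDown (R a c).1 (rowDown (R a c).2 b).1).1 ∧
    R (rowDown a (rowDown c b).1).2 (rowDown c b).2
      = ((rowDown (R a c).1 (rowDown (R a c).2 b).1).2, (rowDown (R a c).2 b).2) := by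
  obtain ⟨d, x⟩ := a
  obtain ⟨e, y⟩ := c
  obtain ⟨s, t⟩ := b
  obtain ⟨e1, e2, e3, e4, e5⟩ := yangBaxter x y s
  -- The carriers cross the solid half of the site, then its dotted half; the energies of the two
  -- crossings add.
  obtain ⟨f1, f2, f3, f4, f5⟩ := mixedYangBaxter (upQ x (downQ y s)) (upQ y s) t
  have e4 := e4 0
  have e5 := e5 0
  have f4 := f4 0
  have f5 := f5 0
  simp only [rowDown_eq, R, e1, e2, e3, f1, f2, f3]
  refine ⟨trivial, Prod.ext (Prod.ext ?_ rfl) (Prod.ext ?_ rfl)⟩ <;> dsimp only <;> linarith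

/-- Two dotted carriers pass through a site. -/
theorem rowUp_exchange (b : Local n) (c : Aff (Bv n m)) (a : Aff (Bv n l)) :
    (rowUp (rowUp b c).2 a).2 = (rowUp (rowUp b (Rvv c a).1).2 (Rvv c a).2).2 ∧
    Rvv (rowUp b c).1 (rowUp (rowUp b c).2 a).1
      = ((rowUp b (Rvv c a).1).1, (rowUp (rowUp b (Rvv c a).1).2 (Rvv c a).2).1) := by
  obtain ⟨d, x⟩ := a
  obtain ⟨e, y⟩ := c
  obtain ⟨s, t⟩ := b
  obtain ⟨e1, e2, e3, e4, e5⟩ := yangBaxter x y t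
  obtain ⟨f1, f2, f3, f4, f5⟩ := mixedYangBaxter (upQ x (downQ y t)) (upQ y t) s
  have e4 := e4 0
  have e5 := e5 0
  have f4 := f4 0
  have f5 := f5 0
  simp only [rowUp_eq, Rvv, e1, e2, e3, f1, f2, f3]
  simp only [P_comm s.1, P_comm (shiftP s _).1] at *
  refine ⟨trivial, Prod.ext (Prod.ext ?_ rfl) (Prod.ext ?_ rfl)⟩ <;> dsimp only <;> linarith

/-- A solid and a dotted carrier pass through a site in opposite directions. -/
theorem rowDown_rowUp_exchange (a : Aff (B n l)) (b : Local n) (c : Aff (Bv n m)) :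
    rowDown (Rv a (rowUp b c).1).2 (rowUp b c).2
      = ((rowUp (rowDown a b).1 (Rv (rowDown a b).2 c).1).2, (Rv (rowDown a b).2 c).2) ∧
    (Rv a (rowUp b c).1).1 = (rowUp (rowDown a b).1 (Rv (rowDown a b).2 c).1).1 := by
  obtain ⟨d, x⟩ := a
  obtain ⟨e, y⟩ := c
  obtain ⟨s, t⟩ := b
  -- The second use has two dotted arrays and a solid one. The same equation covers it, as `Rvv` is
  -- `R` with its arguments reversed and `P` is symmetric.
  obtain ⟨e1, e2, e3, e4, e5⟩ := mixedYangBaxter x s (upQ y t)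
  obtain ⟨f1, f2, f3, f4, f5⟩ := mixedYangBaxter y t (upQ x s)
  have e4 := e4 0
  have e5 := e5 0
  have f4 := f4 0
  have f5 := f5 0
  rw [e3] at f1 f2 f5
  rw [P_comm (upQ y t).1] at f4 f5
  rw [P_comm y.1] at f4 f5
  rw [P_comm t.1, P_comm (downQ y t).1] at f5
  simp only [rowUp_eq, rowDown_eq, Rv, ← f1, ← f2, ← f3, e1, e2]
  refine ⟨Prod.ext rfl (Prod.ext ?_ rfl), Prod.ext ?_ rfl⟩ <;> dsimp only <;> linarith

/-- Two carriers are reflected. -/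
theorem reflection_exchange (κ : Reflector n) (a : Aff (B n l)) (c : Aff (B n m)) :
    Rvv (Rv a (κ.K c)).1 (κ.K (Rv a (κ.K c)).2)
      = ((Rv (R a c).1 (κ.K (R a c).2)).1, κ.K (Rv (R a c).1 (κ.K (R a c).2)).2) := by
  obtain ⟨d, x⟩ := a
  obtain ⟨e, y⟩ := c
  obtain ⟨e1, e2, e3, e4⟩ := reflection κ x y
  simp only [Rv, Rvv, R, Reflector.K, e1, e2]
  refine Prod.ext (Prod.ext ?_ rfl) (Prod.ext ?_ rfl) <;> dsimp only <;> linarith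

end Exchange

section Commutation

/-! ## Two sweeps -/

variable {n : ℕ} [Fact (3 ≤ n)] {κ : Reflector n}

theorem R_u (l m : ℕ) (d e : ℤ) : R (d, u n l) (e, u n m) = ((e, u n m), (d, u n l)) := by
  simp [R, u, upQ_single, downQ_single, Q_single]

theorem Rv_u_uv (κ : Reflector n) (l m : ℕ) (d e : ℤ) :
    Rv (d, u n l) (e, uv κ m) = ((e, uv κ m), (d, u n l)) := by
  have h := one_ne_pos κ
  simp [Rv, uv_eq, u, shiftP_single _ _ h, shiftP_single _ _ h.symm, P_single _ _ h]

theorem Rvv_uv (κ : Reflector n) (l m : ℕ) (d e : ℤ) :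
    Rvv (d, uv κ l) (e, uv κ m) = ((e, uv κ m), (d, uv κ l)) := by
  simp [Rvv, uv_eq, upQ_single, downQ_single, Q_single]

/-- Solid carriers are known far away, so statements about them propagate towards the end. -/
theorem induction_from_far {C : ℕ → Prop} (h : ∃ N, ∀ i, N ≤ i → C i)
    (hs : ∀ i, C (i + 1) → C i) : ∀ i, C i := by
  intro i
  obtain ⟨N, hN⟩ := h
  have key : ∀ k i, N ≤ i + k → C i := by
    intro k
    induction k with
    | zero => exact fun i hi => hN i hi
    | succ k ih => exact fun i hi => hs i (ih (i + 1) (by omega))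
  exact key N i (by omega)

/-- The intermediate state `p†`. -/
noncomputable def daggerState (l : ℕ) (p : State κ) : State κ :=
  ⟨dagger l p, dagger_eventually l p⟩

theorem rowDown_solid (l : ℕ) (p : State κ) (i : ℕ) :
    rowDown (solid l p (i + 1)) (p.site i) = (dagger l p i, solid l p i) :=
  Prod.ext rfl (solid_step l p i).symm

theorem rowUp_dotted (l : ℕ) (p : State κ) (i : ℕ) :
    rowUp (dagger l p i) (dotted l p i) = (dotted l p (i + 1), (T l p).site i) := rfl

/-- The solid carrier of the second sweep, moved across the returning carrier of the first one. -/
theorem Rv_solid_dotted (l m : ℕ) (p : State κ) (i : ℕ) :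
    (Rv (solid l (daggerState m p) i) (dotted m p i)).2 = solid l (T m p) i := by
  revert i
  refine induction_from_far ?_ fun i ih => ?_
  · obtain ⟨N₁, h1⟩ := solid_eventually l (daggerState m p)
    obtain ⟨N₂, h2⟩ := solid_eventually l (T m p)
    obtain ⟨e, N₃, h3⟩ := dotted_eventually m p
    refine ⟨N₁ + N₂ + N₃, fun i hi => ?_⟩
    rw [h1 i (by omega), h2 i (by omega), h3 i (by omega), Rv_u_uv]
  · have h := (rowDown_rowUp_exchange (solid l (daggerState m p) (i + 1)) (dagger m p i)
      (dotted m p i)).1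
    have hd : rowDown (solid l (daggerState m p) (i + 1)) (dagger m p i) = _ :=
      rowDown_solid l (daggerState m p) i
    rw [rowUp_dotted, ih, rowDown_solid, hd] at h
    exact (congrArg Prod.snd h).symm

/-- The returning carrier of the first sweep, moved across the solid carrier of the second one. -/
noncomputable def crossed (l m : ℕ) (p : State κ) (i : ℕ) : Aff (Bv n m) :=
  (Rv (solid l (daggerState m p) i) (dotted m p i)).1

/-- The returning `m`-carrier may act after the incoming `l`-carrier instead of before it. -/
theorem rowUp_crossed (l m : ℕ) (p : State κ) (i : ℕ) :
    rowUp (dagger l (daggerState m p) i) (crossed l m p i)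
      = (crossed l m p (i + 1), dagger l (T m p) i) := by
  have h := rowDown_rowUp_exchange (solid l (daggerState m p) (i + 1)) (dagger m p i)
      (dotted m p i)
  have hd : rowDown (solid l (daggerState m p) (i + 1)) (dagger m p i) = _ :=
    rowDown_solid l (daggerState m p) i
  rw [rowUp_dotted, Rv_solid_dotted, rowDown_solid, hd] at h
  exact Prod.ext h.2.symm (congrArg Prod.fst h.1).symm

theorem R_solid_solid (l m : ℕ) (p : State κ) (i : ℕ) :
    R (solid l (daggerState m p) i) (solid m p i) = (solid m (daggerState l p) i, solid l p i) := by
  revert i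
  refine induction_from_far ?_ fun i ih => ?_
  · obtain ⟨N₁, h1⟩ := solid_eventually l (daggerState m p)
    obtain ⟨N₂, h2⟩ := solid_eventually m (daggerState l p)
    obtain ⟨N₃, h3⟩ := solid_eventually m p
    obtain ⟨N₄, h4⟩ := solid_eventually l p
    refine ⟨N₁ + N₂ + N₃ + N₄, fun i hi => ?_⟩
    rw [h1 i (by omega), h2 i (by omega), h3 i (by omega), h4 i (by omega), R_u]
  · have h := (rowDown_exchange (solid l (daggerState m p) (i + 1)) (solid m p (i + 1))
      (p.site i)).2
    have hm : rowDown (solid l (daggerState m p) (i + 1)) (dagger m p i) = _ :=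
      rowDown_solid l (daggerState m p) i
    have hl : rowDown (solid m (daggerState l p) (i + 1)) (dagger l p i) = _ :=
      rowDown_solid m (daggerState l p) i
    rw [ih] at h
    dsimp only at h
    rw [rowDown_solid, rowDown_solid, hm, hl] at h
    exact h

theorem dagger_daggerState (l m : ℕ) (p : State κ) (i : ℕ) :
    dagger l (daggerState m p) i = dagger m (daggerState l p) i := by
  have h := (rowDown_exchange (solid l (daggerState m p) (i + 1)) (solid m p (i + 1))
    (p.site i)).1
  have hm : rowDown (solid l (daggerState m p) (i + 1)) (dagger m p i) = _ :=
    rowDown_solid l (daggerState m p) i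
  have hl : rowDown (solid m (daggerState l p) (i + 1)) (dagger l p i) = _ :=
    rowDown_solid m (daggerState l p) i
  rw [R_solid_solid] at h
  dsimp only at h
  rw [rowDown_solid, rowDown_solid, hm, hl] at h
  exact h

/-- The reflection equation interchanges the two carriers at the end of the lattice;
`rowUp_exchange` carries this outward along the common state of `dagger_daggerState`. -/
theorem Rvv_crossed_dotted (l m : ℕ) (p : State κ) (i : ℕ) :
    Rvv (crossed l m p i) (dotted l (T m p) i) = (crossed m l p i, dotted m (T l p) i) := by
  induction i with
  | zero =>
    have h := reflection_exchange κ (solid l (daggerState m p) 0) (solid m p 0)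
    have hm : (Rv (solid l (daggerState m p) 0) (κ.K (solid m p 0))).2 = _ :=
      Rv_solid_dotted l m p 0
    have hl : (Rv (solid m (daggerState l p) 0) (κ.K (solid l p 0))).2 = _ :=
      Rv_solid_dotted m l p 0
    rw [R_solid_solid, hm] at h
    dsimp only at h
    rw [hl] at h
    exact h
  | succ i ih =>
    have h := (rowUp_exchange (dagger l (daggerState m p) i) (crossed l m p i)
      (dotted l (T m p) i)).2
    rw [ih] at h
    dsimp only at h
    rw [rowUp_crossed] at h
    dsimp only at h
    rw [rowUp_dotted, dagger_daggerState, rowUp_crossed] at h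
    dsimp only at h
    rw [rowUp_dotted] at h
    exact h

theorem crossed_eventually (l m : ℕ) (p : State κ) :
    ∃ N, ∀ i, N ≤ i → crossed l m p i = dotted m p i := by
  obtain ⟨N₁, h1⟩ := solid_eventually l (daggerState m p)
  obtain ⟨e, N₂, h2⟩ := dotted_eventually m p
  refine ⟨N₁ + N₂, fun i hi => ?_⟩
  rw [crossed, h1 i (by omega), h2 i (by omega), Rv_u_uv]

/-- Far from the end, the carrier returns from `T_m(p)` exactly as it returns from `p`. -/
theorem dotted_T_eventually (l m : ℕ) (p : State κ) :
    ∃ N, ∀ i, N ≤ i → dotted l (T m p) i = dotted l p i := by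
  obtain ⟨N₁, h1⟩ := crossed_eventually l m p
  obtain ⟨N₂, h2⟩ := crossed_eventually m l p
  obtain ⟨e, N₃, h3⟩ := dotted_eventually m p
  obtain ⟨f, N₄, h4⟩ := dotted_eventually l (T m p)
  refine ⟨N₁ + N₂ + N₃ + N₄, fun i hi => ?_⟩
  have h := Rvv_crossed_dotted l m p i
  -- Here `Rvv` is a swap with zero energy, so its first output is the `l`-carrier returning from `T
  -- m p`, exponent included.
  rw [h1 i (by omega), h2 i (by omega), h3 i (by omega), h4 i (by omega), Rvv_uv] at h
  rw [h4 i (by omega)]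
  exact congrArg Prod.fst h

end Commutation

end BoxBall

theorem proposition3p5 {n : ℕ} [Fact (3 ≤ n)] (κ : BoxBall.Reflector n) (l m : ℕ)
    (hl : 1 ≤ l) (hm : 1 ≤ m) (p : BoxBall.State κ) :
    BoxBall.E l (BoxBall.T m p) = BoxBall.E l p := by
  obtain ⟨N, hN⟩ := (BoxBall.E_eq_iff l p _).1 rfl
  obtain ⟨M, hM⟩ := BoxBall.dotted_T_eventually l m p
  refine (BoxBall.E_eq_iff l (BoxBall.T m p) _).2 ⟨N + M, fun i hi => ?_⟩
  rw [hM i (by omega), hN i (by omega)]
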